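/- **Conventions.** An *effect algebra* is a partial algebra $(E;+,0,1)$ such that, for all $a,b,c\in E$: $a+b$ is defined iff $b+a$ is, and then they are equal; $a+b$ and $(a+b)+c$ are defined iff $b+c$ and $a+(b+c)$ are, and then $(a+b)+c=a+(b+c)$; there is a unique $a^-\in E$ with $a+a^-=1$; if $a+1$ is defined, then $a=0$. Write $a\le b$ iff $a+c=b$ for some $c\in E$, and then $c=b-a$. A *homomorphism* preserves $1$ and every defined sum; an *isomorphism* is a bijection that is a homomorphism in both directions. $E$ has the *Riesz Decomposition Property* (RDP) if $a_1+a_2=b_1+b_2$ implies that there are $c_{ij}\in E$ with $a_i=c_{i1}+c_{i2}$ and $b_j=c_{1j}+c_{2j}$ $(i,j=1,2)$; a po-group $G$ has RDP if the same holds with $G^+$ in place of $E$. An *ideal* of $E$ is a nonempty down-closed subset closed under defined sums. It is *maximal* if it is $\neq E$ and not properly contained in another ideal $\neq E$. $E$ is *local* if it has exactly one maximal ideal; $\mathrm{Rad}(E)$ is the intersection of all maximal ideals. If $E$ has RDP and $I$ is an ideal, then $E/I$ is the quotient effect algebra by the congruence $a\sim_I b$ iff $a-e=b-f$ for some $e,f\in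 I$ with $e\le a$, $f\le b$. The ideal $I$ is *retractive* if there is a homomorphism $\delta:E/I\to E$ with $\pi_I\circ\delta=\mathrm{id}_{E/I}$, where $\pi_I:E\to E/I$ is the projection, and *strict* if $x/I<y/I$ implies $x<y$. $E$ is *Archimedean* if $0$ is the only $a\in E$ for which $na=a+\dots+a$ is defined for all $n\ge1$. All po-groups are Abelian. A *unital po-group* $(H,u)$ is a po-group $H$ with an element $u\ge0$ such that every $h\in H$ satisfies $h\le nu$ for some integer $n\ge 0$. For $u\ge0$, $\Gamma(H,u)=[0,u]_H=\{h\in H:0\le h\le u\}$ is the effect algebra in which $a+b$ is defined iff $a+b\le u$, with the group addition, and with unit $u$. A subset of a po-group or of an effect algebra is *directed* if it is upwards and downwards directed. $H$ is *simple* if it is nontrivial and its only directed convex subgroups are $\{0\}$ and $H$; it is an *antilattice* if only comparable elements have an infimum or a supremum. $H\overrightarrow{\times}G$ is the product group with the lexicographic order: $(h,g)\le(h',g')$ iff $h<h'$, or $h=h'$ and $g\le g'$. For a nontrivial unital po-group $(H,u)$, an effect algebra $E$ with RDP is *strong $(H,u)$-perfect* if $E$ is the disjoint union of nonempty sets $E_t$,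 $t\in[0,u]_H$, such that: $\{x^-:x\in E_t\}=E_{u-t}$; if $x\in E_s$, $y\in E_t$ and $x+y$ is defined, then $s+t\le u$ and $x+y\in E_{s+t}$; if $s<t$, then $x\le y$ for all $x\in E_s$, $y\in E_t$; every $E_t$ is directed; and there are elements $c_t\in E_t$, $t\in[0,u]_H$, with $c_u=1$ such that $c_v+c_t$ is defined and equals $c_{v+t}$ whenever $v+t\le u$. **Theorem.** Let $E$ be an effect algebra with RDP. The following statements are equivalent. (i) $E$ is local and $\mathrm{Rad}(E)$ is retractive and strict. (ii) $E$ is strong $(H,u)$-perfect for some antilattice, simple Abelian unital po-group $(H,u)$ with RDP such that $\Gamma(H,u)$ is Archimedean. (iii) There exist an antilattice, simple Abelian unital po-group $(H,u)$ with RDP such that $\Gamma(H,u)$ is Archimedean, and a directed Abelian po-group $G$ with RDP, such that $E\cong\Gamma(H\overrightarrow{\times}G,(u,0))$. -/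

import Mathlib

universe w

/-- An effect algebra `(E; +, 0, 1)`. The partial operation `+` is given by its graph:
`IsSum a b c` says that `a + b` is defined and equals `c`. -/
class EffectAlgebra (E : Type*) extends Zero E, One E where
  IsSum : E → E → E → Prop
  isSum_unique : ∀ {a b c d : E}, IsSum a b c → IsSum a b d → c = d
  isSum_comm : ∀ {a b c : E}, IsSum a b c → IsSum b a c
  isSum_assoc : ∀ {a b c s : E},
    (∃ d, IsSum a b d ∧ IsSum d c s) ↔ (∃ d, IsSum b c d ∧ IsSum a d s)
  exists_unique_compl : ∀ a : E, ∃! b, IsSum a b 1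
  eq_zero_of_isSum_one : ∀ {a c : E}, IsSum a 1 c → a = 0

namespace EffectAlgebra

section Basic

variable {E : Type*} [EffectAlgebra E]

/-- The order of an effect algebra. -/
def Le (a b : E) : Prop := ∃ c, IsSum a c b

/-- The strict order of an effect algebra. -/
def Lt (a b : E) : Prop := Le a b ∧ a ≠ b

/-- The complement `a⁻`, the unique element with `a + a⁻ = 1`. -/
noncomputable def compl (a : E) : E := (exists_unique_compl a).choose

theorem isSum_compl (a : E) : IsSum a (compl a) 1 :=
  (exists_unique_compl a).choose_spec.1

theorem eq_compl {a b : E} (h : IsSum a b 1) : b = compl a :=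
  (exists_unique_compl a).unique h (isSum_compl a)

theorem assoc_right {a b c d s : E} (h : IsSum a b d) (h' : IsSum d c s) :
    ∃ r, IsSum b c r ∧ IsSum a r s := isSum_assoc.1 ⟨d, h, h'⟩

theorem assoc_left {a b c d s : E} (h : IsSum b c d) (h' : IsSum a d s) :
    ∃ r, IsSum a b r ∧ IsSum r c s := isSum_assoc.2 ⟨d, h, h'⟩

theorem isSum_cancel {a b b' c : E} (h : IsSum a b c) (h' : IsSum a b' c) : b = b' := by
  obtain ⟨r, hr, hr'⟩ := assoc_right (isSum_comm h) (isSum_compl c)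
  obtain ⟨q, hq, hq'⟩ := assoc_right (isSum_comm h') (isSum_compl c)
  obtain rfl := isSum_unique hr hq
  rw [eq_compl (isSum_comm hr'), eq_compl (isSum_comm hq')]

theorem zero_isSum (a : E) : IsSum 0 a a := by
  have h1 : IsSum (0 : E) 1 1 := by
    have h := isSum_comm (isSum_compl (1 : E))
    rwa [eq_zero_of_isSum_one h] at h
  obtain ⟨r, hr, hr'⟩ := assoc_left (isSum_compl a) h1
  have e : r = a := by
    rw [eq_compl (isSum_comm hr'), ← eq_compl (isSum_comm (isSum_compl a))]
  rwa [e] at hr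

theorem isSum_zero (a : E) : IsSum a 0 a := isSum_comm (zero_isSum a)

/-- If `a = a₁ + a₂`, `b = b₁ + b₂` and `a + b = s`, then `s = (a₁ + b₁) + (a₂ + b₂)`. -/
theorem isSum_four {a₁ a₂ b₁ b₂ a b s : E} (ha : IsSum a₁ a₂ a) (hb : IsSum b₁ b₂ b)
    (hs : IsSum a b s) : ∃ p q, IsSum a₁ b₁ p ∧ IsSum a₂ b₂ q ∧ IsSum p q s := by
  obtain ⟨r, hr, hr'⟩ := assoc_right ha hs
  obtain ⟨t, ht, ht'⟩ := assoc_left hb hr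
  obtain ⟨q, hq, hq'⟩ := assoc_right (isSum_comm ht) ht'
  obtain ⟨p, hp, hp'⟩ := assoc_left hq' hr'
  exact ⟨p, q, hp, hq, hp'⟩

/-- An ideal of an effect algebra. -/
structure IsIdeal (I : Set E) : Prop where
  nonempty : I.Nonempty
  down : ∀ {a b : E}, Le a b → b ∈ I → a ∈ I
  add : ∀ {a b c : E}, a ∈ I → b ∈ I → IsSum a b c → c ∈ I

theorem IsIdeal.zero_mem {I : Set E} (hI : IsIdeal I) : (0 : E) ∈ I := by
  obtain ⟨a, ha⟩ := hI.nonempty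
  exact hI.down ⟨a, zero_isSum a⟩ ha

/-- A maximal ideal: a proper ideal that is not properly contained in another proper ideal. -/
def IsMaximalIdeal (I : Set E) : Prop :=
  IsIdeal I ∧ I ≠ Set.univ ∧ ∀ J : Set E, IsIdeal J → J ≠ Set.univ → ¬ I ⊂ J

variable (E) in
/-- The Riesz Decomposition Property of an effect algebra. -/
def HasRDP : Prop :=
  ∀ a₁ a₂ b₁ b₂ s : E, IsSum a₁ a₂ s → IsSum b₁ b₂ s →
    ∃ c₁₁ c₁₂ c₂₁ c₂₂ : E,
      IsSum c₁₁ c₁₂ a₁ ∧ IsSum c₂₁ c₂₂ a₂ ∧ IsSum c₁₁ c₂₁ b₁ ∧ IsSum c₁₂ c₂₂ b₂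

variable (E) in
/-- A local effect algebra: there is a unique maximal ideal. -/
def IsLocal : Prop := ∃! I : Set E, IsMaximalIdeal I

variable (E) in
/-- The radical: the intersection of all maximal ideals. -/
def Rad : Set E := ⋂₀ {I : Set E | IsMaximalIdeal I}

variable (E) in
theorem isIdeal_rad : IsIdeal (Rad E) where
  nonempty := ⟨0, fun _ hI => hI.1.zero_mem⟩
  down h hb := fun I hI => hI.1.down h (hb I hI)
  add ha hb h := fun I hI => hI.1.add (ha I hI) (hb I hI) h

/-- `IsMultiple n a b`: the multiple `n a` is defined and equals `b`. -/
def IsMultiple : ℕ → E → E → Prop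
  | 0, _, b => b = 0
  | n + 1, a, b => ∃ c, IsMultiple n a c ∧ IsSum c a b

variable (E) in
/-- The set of infinitesimal elements. -/
def Infin : Set E := {a | ∀ n : ℕ, 1 ≤ n → ∃ b, IsMultiple n a b}

variable (E) in
/-- An Archimedean effect algebra: `0` is the only infinitesimal element. -/
def IsArchimedean : Prop := Infin E = {0}

end Basic

/-- A homomorphism of effect algebras. -/
structure IsHom {E F : Type*} [EffectAlgebra E] [EffectAlgebra F] (h : E → F) : Prop where
  map_one : h 1 = 1
  map_sum : ∀ {a b c : E}, IsSum a b c → IsSum (h a) (h b) (h c)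

/-- Isomorphic effect algebras: there is a bijection such that it and its inverse are
homomorphisms. -/
def Isomorphic (E F : Type*) [EffectAlgebra E] [EffectAlgebra F] : Prop :=
  ∃ f : E ≃ F, IsHom f ∧ IsHom f.symm

section Quotient

variable {E : Type*} [EffectAlgebra E]

/-- The relation `a ∼ b` iff `a - e = b - f` for some `e, f ∈ I` with `e ≤ a`, `f ≤ b`. -/
def Rel (I : Set E) (a b : E) : Prop :=
  ∃ e ∈ I, ∃ f ∈ I, ∃ c, IsSum e c a ∧ IsSum f c b

theorem Rel.symm {I : Set E} {a b : E} (h : Rel I a b) : Rel I b a := by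
  obtain ⟨e, he, f, hf, c, h1, h2⟩ := h
  exact ⟨f, hf, e, he, c, h2, h1⟩

theorem Rel.trans (hE : HasRDP E) {I : Set E} (hI : IsIdeal I) {x y z : E}
    (h : Rel I x y) (h' : Rel I y z) : Rel I x z := by
  obtain ⟨e, he, f, hf, c, h1, h2⟩ := h
  obtain ⟨g, hg, k, hk, d, h3, h4⟩ := h'
  obtain ⟨r1, r2, r3, r4, s1, s2, s3, s4⟩ := hE _ _ _ _ _ h2 h3
  obtain ⟨p, hp, hp'⟩ := assoc_left s2 h1
  obtain ⟨q, hq, hq'⟩ := assoc_left s4 h4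
  exact ⟨p, hI.add he (hI.down ⟨r1, isSum_comm s3⟩ hg) hp,
    q, hI.add hk (hI.down ⟨r1, isSum_comm s1⟩ hf) hq, r4, hp', hq'⟩

/-- If `x = e + y` with `e ∈ I` then `x ∼ y`. -/
theorem rel_of_isSum {I : Set E} (hI : IsIdeal I) {e x y : E} (he : e ∈ I)
    (h : IsSum e y x) : Rel I x y := ⟨e, he, 0, hI.zero_mem, y, h, zero_isSum y⟩

theorem Rel.add {I : Set E} (hI : IsIdeal I) {x y z x' y' z' : E}
    (hx : Rel I x x') (hy : Rel I y y') (h : IsSum x y z) (h' : IsSum x' y' z') :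
    Rel I z z' := by
  obtain ⟨e, he, f, hf, c, h1, h2⟩ := hx
  obtain ⟨g, hg, k, hk, d, h3, h4⟩ := hy
  obtain ⟨p, q, hp, hq, hs⟩ := isSum_four h1 h3 h
  obtain ⟨p', q', hp', hq', hs'⟩ := isSum_four h2 h4 h'
  obtain rfl := isSum_unique hq hq'
  exact ⟨p, hI.add he hg hp, p', hI.add hf hk hp', q, hs, hs'⟩

/-- If `o ∼ 1` then the complement of `o` lies in `I`. -/
theorem compl_mem {I : Set E} (hI : IsIdeal I) {o k : E} (h : Rel I o 1)
    (hk : IsSum o k 1) : k ∈ I := by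
  obtain ⟨e, he, f, hf, m, h1, h2⟩ := h
  obtain ⟨r, hr, hr'⟩ := assoc_right (isSum_comm h1) hk
  obtain rfl := isSum_cancel hr' (isSum_comm h2)
  exact hI.down ⟨e, isSum_comm hr⟩ hf

theorem Rel.compl (hE : HasRDP E) {I : Set E} (hI : IsIdeal I) {x x' y y' : E}
    (h : Rel I x x') (hy : IsSum x y 1) (hy' : IsSum x' y' 1) : Rel I y y' := by
  obtain ⟨e, he, f, hf, c, h1, h2⟩ := h
  obtain ⟨r, hr, hr'⟩ := assoc_right (isSum_comm h1) hy
  obtain ⟨q, hq, hq'⟩ := assoc_right (isSum_comm h2) hy'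
  obtain rfl := isSum_cancel hr' hq'
  exact (rel_of_isSum hI he hr).symm.trans hE hI (rel_of_isSum hI hf hq)

/-- The congruence of an ideal of an effect algebra with RDP. -/
def idealSetoid (hE : HasRDP E) {I : Set E} (hI : IsIdeal I) : Setoid E where
  r := Rel I
  iseqv := ⟨fun a => rel_of_isSum hI hI.zero_mem (zero_isSum a), Rel.symm, Rel.trans hE hI⟩

/-- The quotient `E/I` of an effect algebra with RDP by an ideal. -/
def Quo (hE : HasRDP E) {I : Set E} (hI : IsIdeal I) : Type _ := Quotient (idealSetoid hE hI)

/-- The canonical projection `E → E/I`. -/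
def proj (hE : HasRDP E) {I : Set E} (hI : IsIdeal I) (x : E) : Quo hE hI :=
  Quotient.mk (idealSetoid hE hI) x

theorem proj_eq {hE : HasRDP E} {I : Set E} {hI : IsIdeal I} {x y : E} :
    proj hE hI x = proj hE hI y ↔ Rel I x y :=
  Quotient.eq (r := idealSetoid hE hI)

theorem proj_surj {hE : HasRDP E} {I : Set E} {hI : IsIdeal I} (X : Quo hE hI) :
    ∃ x, proj hE hI x = X := Quotient.exists_rep X

/-- The effect algebra structure of `E/I`: `x/I + y/I = z/I` iff there are representatives
whose sum is defined in `E` and represents `z/I`. -/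
instance (hE : HasRDP E) {I : Set E} (hI : IsIdeal I) : EffectAlgebra (Quo hE hI) where
  zero := proj hE hI 0
  one := proj hE hI 1
  IsSum X Y Z := ∃ x y z, proj hE hI x = X ∧ proj hE hI y = Y ∧ proj hE hI z = Z ∧ IsSum x y z
  isSum_unique := by
    rintro _ _ _ _ ⟨x, y, z, rfl, rfl, rfl, h⟩ ⟨x', y', z', hx, hy, rfl, h'⟩
    exact proj_eq.2 (Rel.add hI (proj_eq.1 hx).symm (proj_eq.1 hy).symm h h')
  isSum_comm := by
    rintro _ _ _ ⟨x, y, z, rfl, rfl, rfl, h⟩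
    exact ⟨y, x, z, rfl, rfl, rfl, isSum_comm h⟩
  isSum_assoc := by
    intro A B C S
    constructor
    · rintro ⟨D, ⟨x, y, d, rfl, rfl, rfl, h⟩, ⟨d', c, s, hd, rfl, rfl, h'⟩⟩
      obtain ⟨f, hf, e, he, m, h2, h1⟩ := proj_eq.1 hd
      obtain ⟨x1, y1, x2, y2, s1, s2, s3, s4⟩ := hE _ _ _ _ _ h1 h
      -- `e = x1 + y1`, `m = x2 + y2`, `x = x1 + x2`, `y = y1 + y2`
      obtain ⟨w, hw, hw'⟩ := assoc_right h2 h'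
      obtain ⟨v, hv, hv'⟩ := assoc_right s2 hw
      have hx1 : x1 ∈ I := hI.down ⟨y1, s1⟩ he
      have hy1 : y1 ∈ I := hI.down ⟨x1, isSum_comm s1⟩ he
      refine ⟨proj hE hI v, ⟨y2, c, v, ?_, rfl, rfl, hv⟩, ⟨x2, v, w, ?_, rfl, ?_, hv'⟩⟩
      · exact proj_eq.2 (rel_of_isSum hI hy1 s4).symm
      · exact proj_eq.2 (rel_of_isSum hI hx1 s3).symm
      · exact proj_eq.2 (rel_of_isSum hI hf hw').symm
    · rintro ⟨D, ⟨y, x, d, rfl, rfl, rfl, h⟩, ⟨c, d', s, rfl, hd, rfl, h'⟩⟩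
      obtain ⟨f, hf, e, he, m, h2, h1⟩ := proj_eq.1 hd
      obtain ⟨y1, x1, y2, x2, s1, s2, s3, s4⟩ := hE _ _ _ _ _ h1 h
      obtain ⟨w, hw, hw'⟩ := assoc_right h2 (isSum_comm h')
      obtain ⟨v, hv, hv'⟩ := assoc_left s2 (isSum_comm hw)
      have hx1 : x1 ∈ I := hI.down ⟨y1, isSum_comm s1⟩ he
      have hy1 : y1 ∈ I := hI.down ⟨x1, s1⟩ he
      refine ⟨proj hE hI v, ⟨c, y2, v, rfl, ?_, rfl, hv⟩, ⟨v, x2, w, rfl, ?_, ?_, hv'⟩⟩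
      · exact proj_eq.2 (rel_of_isSum hI hy1 s3).symm
      · exact proj_eq.2 (rel_of_isSum hI hx1 s4).symm
      · exact proj_eq.2 (rel_of_isSum hI hf hw').symm
  exists_unique_compl := by
    intro A
    obtain ⟨a, rfl⟩ := proj_surj A
    refine ⟨proj hE hI (compl a), ⟨a, compl a, 1, rfl, rfl, rfl, isSum_compl a⟩, ?_⟩
    rintro _ ⟨x, y, o, hx, rfl, ho, h⟩
    have hk := compl_mem hI (proj_eq.1 ho) (isSum_compl o)
    obtain ⟨r, hr, hr'⟩ := assoc_right h (isSum_compl o)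
    have h1 : Rel I r y := rel_of_isSum hI hk (isSum_comm hr)
    exact proj_eq.2 (h1.symm.trans hE hI
      (Rel.compl hE hI (proj_eq.1 hx) hr' (isSum_compl a)))
  eq_zero_of_isSum_one := by
    rintro _ _ ⟨x, y, z, rfl, hy, rfl, h⟩
    have hk := compl_mem hI (proj_eq.1 hy) (isSum_compl y)
    obtain ⟨r, hr, hr'⟩ := assoc_right (isSum_comm h) (isSum_compl z)
    have hx : x ∈ I := hI.down ⟨compl z, by rwa [eq_compl hr'] at hr⟩ hk
    exact proj_eq.2 (rel_of_isSum hI hx (isSum_zero x))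

/-- A strict ideal: `x/I < y/I` implies `x < y`. -/
def IsStrict (hE : HasRDP E) {I : Set E} (hI : IsIdeal I) : Prop :=
  ∀ x y : E, Lt (proj hE hI x) (proj hE hI y) → Lt x y

/-- A retractive ideal: the canonical projection has a right inverse that is a homomorphism. -/
def IsRetractive (hE : HasRDP E) {I : Set E} (hI : IsIdeal I) : Prop :=
  ∃ δ : Quo hE hI → E, IsHom δ ∧ ∀ X, proj hE hI (δ X) = X

end Quotient

/-! Abelian po-groups and their intervals -/

/-- `s` is directed (upwards and downwards) for the relation `r`. -/
def IsDirectedSet {α : Type*} (r : α → α → Prop) (s : Set α) : Prop :=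
  DirectedOn r s ∧ DirectedOn (fun a b => r b a) s

/-- An antilattice: only comparable elements have an infimum or a supremum. -/
def IsAntilattice (P : Type*) [PartialOrder P] : Prop :=
  ∀ a b : P, ((∃ c, IsGLB {a, b} c) ∨ (∃ c, IsLUB {a, b} c)) → a ≤ b ∨ b ≤ a

section PoGroup

variable {G : Type*} [AddCommGroup G] [PartialOrder G]

/-- A strong unit of an Abelian po-group. -/
structure IsStrongUnit (u : G) : Prop where
  nonneg : 0 ≤ u
  bound : ∀ g : G, ∃ n : ℕ, g ≤ n • u

variable (G) in
/-- A directed po-group. -/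
def IsDirectedGroup : Prop := IsDirectedSet (fun a b : G => a ≤ b) Set.univ

variable (G) in
/-- The Riesz Decomposition Property of an Abelian po-group. -/
def GroupHasRDP : Prop :=
  ∀ a₁ a₂ b₁ b₂ : G, 0 ≤ a₁ → 0 ≤ a₂ → 0 ≤ b₁ → 0 ≤ b₂ → a₁ + a₂ = b₁ + b₂ →
    ∃ c₁₁ c₁₂ c₂₁ c₂₂ : G, 0 ≤ c₁₁ ∧ 0 ≤ c₁₂ ∧ 0 ≤ c₂₁ ∧ 0 ≤ c₂₂ ∧
      a₁ = c₁₁ + c₁₂ ∧ a₂ = c₂₁ + c₂₂ ∧ b₁ = c₁₁ + c₂₁ ∧ b₂ = c₁₂ + c₂₂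

/-- An o-ideal: a directed convex subgroup. -/
def IsOIdeal (K : AddSubgroup G) : Prop :=
  IsDirectedSet (fun a b : G => a ≤ b) (K : Set G) ∧ (K : Set G).OrdConnected

variable (G) in
/-- A simple po-group: it has exactly two o-ideals, `{0}` and the whole group. -/
def IsSimplePoGroup : Prop :=
  Nontrivial G ∧ ∀ K : AddSubgroup G, IsOIdeal K → K = ⊥ ∨ K = ⊤

/-- The underlying set `[0, u]` of `Γ(G, u)`, for `u ≥ 0`. -/
def Gam (u : G) (_ : 0 ≤ u) : Type _ := Set.Icc (0 : G) u

/-- The effect algebra `Γ(G, u)`: the group addition, restricted to `[0, u]`. -/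
instance [IsOrderedAddMonoid G] (u : G) (hu : 0 ≤ u) : EffectAlgebra (Gam u hu) where
  zero := ⟨0, le_rfl, hu⟩
  one := ⟨u, hu, le_rfl⟩
  IsSum a b c := a.1 + b.1 = c.1
  isSum_unique h h' := Subtype.ext (h.symm.trans h')
  isSum_comm h := (add_comm _ _).trans h
  isSum_assoc := by
    rintro ⟨a, ha⟩ ⟨b, hb⟩ ⟨c, hc⟩ ⟨s, hs⟩
    constructor
    · rintro ⟨⟨d, hd⟩, h, h'⟩
      simp only at h h'
      have e : a + (b + c) = s := by rw [← h', ← h, add_assoc]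
      exact ⟨⟨b + c, add_nonneg hb.1 hc.1,
        (le_add_of_nonneg_left ha.1).trans (e.le.trans hs.2)⟩, rfl, e⟩
    · rintro ⟨⟨d, hd⟩, h, h'⟩
      simp only at h h'
      have e : a + b + c = s := by rw [← h', ← h, add_assoc]
      exact ⟨⟨a + b, add_nonneg ha.1 hb.1,
        (le_add_of_nonneg_right hc.1).trans (e.le.trans hs.2)⟩, rfl, e⟩
  exists_unique_compl := by
    rintro ⟨a, ha⟩
    refine ⟨⟨u - a, sub_nonneg.2 ha.2, sub_le_self _ ha.1⟩, add_sub_cancel a u, ?_⟩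
    rintro ⟨b, hb⟩ h
    exact Subtype.ext (eq_sub_of_add_eq' h)
  eq_zero_of_isSum_one := by
    rintro ⟨a, ha⟩ ⟨c, hc⟩ h
    have h' : a + u = c := h
    have h2 : a + u ≤ u := h'.le.trans hc.2
    exact Subtype.ext (le_antisymm (add_le_iff_nonpos_left.1 h2) ha.1)

end PoGroup

/-- The element `(u, 0)` is nonnegative in the lexicographic product. -/
theorem lex_nonneg {H G : Type*} [AddCommGroup H] [PartialOrder H] [AddCommGroup G]
    [PartialOrder G] {u : H} (hu : 0 ≤ u) : (0 : H ×ₗ G) ≤ toLex (u, 0) := by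
  rcases hu.lt_or_eq with h | h
  · exact Prod.Lex.toLex_le_toLex.2 (Or.inl h)
  · exact Prod.Lex.toLex_le_toLex.2 (Or.inr ⟨h, le_rfl⟩)

/-! Decompositions indexed by the interval `[0, u]` of a unital Abelian po-group -/

section Decomposition

variable {E : Type*} [EffectAlgebra E] {H : Type*} [AddCommGroup H] [PartialOrder H]

/-- An `(H, u)`-decomposition of `E`. In `compl_eq` and `sum_mem`, the element `r` of `[0, u]`
is `u - t` and `s + t`, respectively. -/
structure IsDecomposition (u : H) (D : Set.Icc (0 : H) u → Set E) : Prop where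
  nonempty : ∀ t, (D t).Nonempty
  disjoint : ∀ s t, s ≠ t → D s ∩ D t = ∅
  cover : ⋃ t, D t = Set.univ
  compl_eq : ∀ t r : Set.Icc (0 : H) u, (r : H) = u - t → compl '' D t = D r
  sum_mem : ∀ (s t : Set.Icc (0 : H) u) (x y z : E), x ∈ D s → y ∈ D t → IsSum x y z →
    ∃ r : Set.Icc (0 : H) u, (r : H) = s + t ∧ z ∈ D r

/-- An ordered decomposition: `E_s ≤ E_t` whenever `s < t`. -/
def IsOrderedDec {u : H} (D : Set.Icc (0 : H) u → Set E) : Prop :=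
  ∀ s t : Set.Icc (0 : H) u, s < t → ∀ x ∈ D s, ∀ y ∈ D t, Le x y

/-- A directed decomposition: every `E_t` is directed. -/
def IsDirectedDec {u : H} (D : Set.Icc (0 : H) u → Set E) : Prop :=
  ∀ t : Set.Icc (0 : H) u, IsDirectedSet (fun a b : E => Le a b) (D t)

/-- A strong `(H, u)`-decomposition: an ordered and directed decomposition with elements
`c_t ∈ E_t` such that `c_v + c_t = c_{v+t}` whenever `v + t ≤ u`, and `c_u = 1`. -/
def IsStrongDecomposition (u : H) (D : Set.Icc (0 : H) u → Set E) : Prop :=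
  IsDecomposition u D ∧ IsOrderedDec D ∧ IsDirectedDec D ∧
    ∃ c : Set.Icc (0 : H) u → E,
      (∀ t, c t ∈ D t) ∧
      (∀ v t r : Set.Icc (0 : H) u, (r : H) = v + t → IsSum (c v) (c t) (c r)) ∧
      (∀ r : Set.Icc (0 : H) u, (r : H) = u → c r = 1)

variable (E) in
/-- A strong `(H, u)`-perfect effect algebra, for a nontrivial po-group `H`. -/
def IsStrongPerfect (u : H) : Prop :=
  HasRDP E ∧ Nontrivial H ∧ ∃ D : Set.Icc (0 : H) u → Set E, IsStrongDecomposition u D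

end Decomposition

end EffectAlgebra

/-! The main tool is `exists_isAmbient`: an effect algebra with RDP is an interval of a unital
po-group with RDP. The group consists of differences of finite multisets over the algebra, two
multisets being identified when they have a common refinement. RDP makes refinement confluent; this
gives transitivity and cancellation, and it keeps the original sums intact.

From (i) to (iii), this is applied to both E and E/Rad(E). Maximality of the radical leaves E/Rad(E)
without proper nonzero ideals, so its group H is simple. A simple po-group with RDP is an
antilattice, and its intervals are Archimedean. Strictness allows radical elements to be added
outside the class 1 and subtracted outside the class 0. Hence all sums of radical elements exist,
and their differences form a subgroup G of the group of E. The retraction δ picks an origin in every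
class; the coordinates of x are its class and its offset from that origin (`isomorphic_lex`).

From (iii) to (ii), the fibres of the first coordinate form the decomposition, with c_t = (t, 0).
From (ii) to (i), an ideal that meets E_t for some t ≠ 0 contains c_t, and simplicity of H then
forces it to contain c_u = 1 (`ideal_eq_univ`). So E_0 is the only maximal ideal; its congruence
classes are the sets E_t, and x/E_0 ↦ c_t for x in E_t is the retraction. -/

namespace EffectAlgebra

/-! ### Refinement of multisets over an effect algebra. -/

section Words

variable {E : Type*} [EffectAlgebra E]

theorem eq_zero_of_isSum_zero {a b : E} (h : IsSum a b 0) : a = 0 := by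
  obtain ⟨r, hr, hr'⟩ := assoc_right h (zero_isSum 1)
  have hb : b = 0 := eq_zero_of_isSum_one hr
  subst hb
  exact isSum_unique (isSum_zero a) h

/-- `MSum s a`: the sum of the multiset `s` is defined and equals `a`. -/
inductive MSum : Multiset E → E → Prop
  | zero : MSum 0 0
  | cons {a b c : E} {s : Multiset E} : IsSum a b c → MSum s b → MSum (a ::ₘ s) c

theorem mSum_zero_iff {c : E} : MSum 0 c ↔ c = 0 := by
  refine ⟨fun h => ?_, fun h => h ▸ MSum.zero⟩
  generalize hw : (0 : Multiset E) = w at h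
  cases h with
  | zero => rfl
  | cons _ _ => exact absurd hw (Multiset.zero_ne_cons)

/-- Inversion is not immediate, since the derivation may have split off another element first;
associativity and commutativity exchange the two. -/
theorem mSum_cons_iff {a c : E} {s : Multiset E} :
    MSum (a ::ₘ s) c ↔ ∃ b, IsSum a b c ∧ MSum s b := by
  refine ⟨fun h => ?_, fun ⟨b, h, h'⟩ => MSum.cons h h'⟩
  generalize hw : a ::ₘ s = w at h
  induction h generalizing s with
  | zero => exact absurd hw.symm (Multiset.zero_ne_cons)
  | @cons a' b' c' s' h h' ih =>
    rcases Multiset.cons_eq_cons.1 hw with ⟨rfl, rfl⟩ | ⟨_, t, rfl, rfl⟩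
    · exact ⟨b', h, h'⟩
    · obtain ⟨d, hd, hd'⟩ := ih rfl
      obtain ⟨r, hr, hr'⟩ := assoc_left hd h
      obtain ⟨q, hq, hq'⟩ := assoc_right (isSum_comm hr) hr'
      exact ⟨q, hq', MSum.cons hq hd'⟩

theorem mSum_singleton_iff {a c : E} : MSum {a} c ↔ a = c := by
  rw [← Multiset.cons_zero, mSum_cons_iff]
  constructor
  · rintro ⟨b, h, h'⟩
    rw [mSum_zero_iff.1 h'] at h
    exact isSum_unique (isSum_zero a) h
  · rintro rfl
    exact ⟨0, isSum_zero a, MSum.zero⟩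

theorem mSum_add_iff {s t : Multiset E} {c : E} :
    MSum (s + t) c ↔ ∃ a b, MSum s a ∧ MSum t b ∧ IsSum a b c := by
  induction s using Multiset.induction_on generalizing c with
  | empty =>
    rw [zero_add]
    constructor
    · exact fun h => ⟨0, c, MSum.zero, h, zero_isSum c⟩
    · rintro ⟨a, b, ha, hb, h⟩
      rw [mSum_zero_iff.1 ha] at h
      rwa [isSum_unique h (zero_isSum b)]
  | cons x s ih =>
    rw [Multiset.cons_add, mSum_cons_iff]
    constructor
    · rintro ⟨d, hd, h⟩
      obtain ⟨a, b, ha, hb, h⟩ := ih.1 h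
      obtain ⟨r, hr, hr'⟩ := assoc_left h hd
      exact ⟨r, b, MSum.cons hr ha, hb, hr'⟩
    · rintro ⟨a, b, ha, hb, h⟩
      obtain ⟨d, hd, hd'⟩ := mSum_cons_iff.1 ha
      obtain ⟨r, hr, hr'⟩ := assoc_right hd h
      exact ⟨r, hr', ih.2 ⟨d, b, hd', hb, hr⟩⟩

theorem mSum_unique {s : Multiset E} {a b : E} (h : MSum s a) (h' : MSum s b) : a = b := by
  induction s using Multiset.induction_on generalizing a b with
  | empty => rw [mSum_zero_iff.1 h, mSum_zero_iff.1 h']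
  | cons x s ih =>
    obtain ⟨c, hc, hc'⟩ := mSum_cons_iff.1 h
    obtain ⟨d, hd, hd'⟩ := mSum_cons_iff.1 h'
    obtain rfl := ih hc' hd'
    exact isSum_unique hc hd

/-- `Ref s t`: the multiset `t` refines `s`, that is, `t` is obtained from `s` by replacing each
element with a multiset that sums to it. -/
inductive Ref : Multiset E → Multiset E → Prop
  | zero : Ref 0 0
  | cons {a : E} {s t t' : Multiset E} : MSum t a → Ref s t' → Ref (a ::ₘ s) (t + t')

theorem ref_zero_iff {t : Multiset E} : Ref 0 t ↔ t = 0 := by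
  refine ⟨fun h => ?_, fun h => h ▸ Ref.zero⟩
  generalize hw : (0 : Multiset E) = w at h
  cases h with
  | zero => rfl
  | cons _ _ => exact absurd hw (Multiset.zero_ne_cons)

theorem ref_cons_iff {a : E} {s t : Multiset E} :
    Ref (a ::ₘ s) t ↔ ∃ p q, MSum p a ∧ Ref s q ∧ t = p + q := by
  refine ⟨fun h => ?_, fun ⟨p, q, h, h', e⟩ => e ▸ Ref.cons h h'⟩
  generalize hw : a ::ₘ s = w at h
  induction h generalizing s with
  | zero => exact absurd hw.symm (Multiset.zero_ne_cons)
  | @cons a' s' t t' h h' ih =>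
    rcases Multiset.cons_eq_cons.1 hw with ⟨rfl, rfl⟩ | ⟨_, r, rfl, rfl⟩
    · exact ⟨t, t', h, h', rfl⟩
    · obtain ⟨p, q, hp, hq, rfl⟩ := ih rfl
      exact ⟨p, t + q, hp, Ref.cons h hq, by rw [add_left_comm]⟩

theorem ref_add_iff {s₁ s₂ t : Multiset E} :
    Ref (s₁ + s₂) t ↔ ∃ t₁ t₂, Ref s₁ t₁ ∧ Ref s₂ t₂ ∧ t = t₁ + t₂ := by
  induction s₁ using Multiset.induction_on generalizing t with
  | empty =>
    simp [ref_zero_iff]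
  | cons x s ih =>
    rw [Multiset.cons_add, ref_cons_iff]
    constructor
    · rintro ⟨p, q, hp, hq, rfl⟩
      obtain ⟨t₁, t₂, h₁, h₂, rfl⟩ := ih.1 hq
      exact ⟨p + t₁, t₂, Ref.cons hp h₁, h₂, (add_assoc _ _ _).symm⟩
    · rintro ⟨t₁, t₂, h₁, h₂, rfl⟩
      obtain ⟨p, q, hp, hq, rfl⟩ := ref_cons_iff.1 h₁
      exact ⟨p, q + t₂, hp, ih.2 ⟨q, t₂, hq, h₂, rfl⟩, add_assoc _ _ _⟩

theorem Ref.add {s₁ s₂ t₁ t₂ : Multiset E} (h₁ : Ref s₁ t₁) (h₂ : Ref s₂ t₂) :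
    Ref (s₁ + s₂) (t₁ + t₂) := ref_add_iff.2 ⟨t₁, t₂, h₁, h₂, rfl⟩

theorem ref_singleton_iff {a : E} {t : Multiset E} : Ref {a} t ↔ MSum t a := by
  rw [← Multiset.cons_zero, ref_cons_iff]
  simp [ref_zero_iff]

theorem Ref.refl (s : Multiset E) : Ref s s := by
  induction s using Multiset.induction_on with
  | empty => exact Ref.zero
  | cons x s ih =>
    rw [← Multiset.singleton_add]
    exact (ref_singleton_iff.2 (mSum_singleton_iff.2 rfl)).add ih

theorem MSum.ref {s t : Multiset E} {a : E} (h : MSum s a) (h' : Ref s t) : MSum t a := by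
  induction s using Multiset.induction_on generalizing t a with
  | empty => rwa [ref_zero_iff.1 h']
  | cons x s ih =>
    obtain ⟨b, hb, hb'⟩ := mSum_cons_iff.1 h
    obtain ⟨p, q, hp, hq, rfl⟩ := ref_cons_iff.1 h'
    exact mSum_add_iff.2 ⟨x, b, hp, ih hb' hq, hb⟩

theorem Ref.trans {r s t : Multiset E} (h : Ref r s) (h' : Ref s t) : Ref r t := by
  induction r using Multiset.induction_on generalizing s t with
  | empty =>
    rw [ref_zero_iff.1 h] at h'
    exact h'
  | cons x r ih =>
    obtain ⟨p, q, hp, hq, rfl⟩ := ref_cons_iff.1 h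
    obtain ⟨t₁, t₂, h₁, h₂, rfl⟩ := ref_add_iff.1 h'
    exact Ref.cons (hp.ref h₁) (ih hq h₂)

/-- RDP for a binary sum against a sum of arbitrary length, by splitting off one letter at a time.
-/
theorem MSum.split (hE : HasRDP E) {t : Multiset E} {a b c : E} (h : MSum t c)
    (hc : IsSum a b c) : ∃ p q, MSum p a ∧ MSum q b ∧ Ref t (p + q) := by
  induction t using Multiset.induction_on generalizing a b c with
  | empty =>
    rw [mSum_zero_iff.1 h] at hc
    refine ⟨0, 0, mSum_zero_iff.2 (eq_zero_of_isSum_zero hc),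
      mSum_zero_iff.2 (eq_zero_of_isSum_zero (isSum_comm hc)), Ref.zero⟩
  | cons x t ih =>
    obtain ⟨d, hd, hd'⟩ := mSum_cons_iff.1 h
    obtain ⟨c₁, c₂, c₃, c₄, h1, h2, h3, h4⟩ := hE _ _ _ _ _ hc hd
    obtain ⟨p, q, hp, hq, hr⟩ := ih hd' h4
    refine ⟨c₁ ::ₘ p, c₃ ::ₘ q, MSum.cons h1 hp, MSum.cons h2 hq, ?_⟩
    have e : c₁ ::ₘ p + c₃ ::ₘ q = ({c₁} + {c₃}) + (p + q) := by
      rw [← Multiset.singleton_add, ← Multiset.singleton_add, add_add_add_comm]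
    rw [e]
    exact Ref.cons (mSum_add_iff.2
      ⟨c₁, c₃, mSum_singleton_iff.2 rfl, mSum_singleton_iff.2 rfl, h3⟩) hr

/-- The second word is split along the first letter and the remaining sum of the first word, and
induction handles the rest. If the first word is empty, every letter of the second is 0 and is
refined by the empty word. -/
theorem MSum.exists_common_ref (hE : HasRDP E) {s t : Multiset E} {c : E} (hs : MSum s c)
    (ht : MSum t c) : ∃ r, Ref s r ∧ Ref t r := by
  induction s using Multiset.induction_on generalizing t c with
  | empty =>
    rw [mSum_zero_iff.1 hs] at ht
    refine ⟨0, Ref.zero, ?_⟩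
    clear hs
    induction t using Multiset.induction_on with
    | empty => exact Ref.zero
    | cons x t ih =>
      obtain ⟨d, hd, hd'⟩ := mSum_cons_iff.1 ht
      obtain rfl := eq_zero_of_isSum_zero hd
      obtain rfl := eq_zero_of_isSum_zero (isSum_comm hd)
      exact Ref.cons MSum.zero (ih hd')
  | cons x s ih =>
    obtain ⟨b, hb, hb'⟩ := mSum_cons_iff.1 hs
    obtain ⟨p, q, hp, hq, hr⟩ := ht.split hE hb
    obtain ⟨r, h1, h2⟩ := ih hb' hq
    exact ⟨p + r, Ref.cons hp h1, hr.trans ((Ref.refl p).add h2)⟩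

theorem Ref.confluent (hE : HasRDP E) {w s t : Multiset E} (hs : Ref w s) (ht : Ref w t) :
    ∃ r, Ref s r ∧ Ref t r := by
  induction w using Multiset.induction_on generalizing s t with
  | empty =>
    rw [ref_zero_iff.1 hs, ref_zero_iff.1 ht]
    exact ⟨0, Ref.zero, Ref.zero⟩
  | cons x w ih =>
    obtain ⟨p, q, hp, hq, rfl⟩ := ref_cons_iff.1 hs
    obtain ⟨p', q', hp', hq', rfl⟩ := ref_cons_iff.1 ht
    obtain ⟨r, h1, h2⟩ := hp.exists_common_ref hE hp'
    obtain ⟨r', h1', h2'⟩ := ih hq hq'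
    exact ⟨r + r', h1.add h1', h2.add h2'⟩

/-- Two multisets are similar if they have a common refinement. -/
def Sim (s t : Multiset E) : Prop := ∃ r, Ref s r ∧ Ref t r

/-- RDP of the free commutative monoid; RDP of the constructed group descends from it. -/
theorem exists_multiset_refinement {α : Type*} {p q p' q' : Multiset α} (h : p + q = p' + q') :
    ∃ x₁ x₂ x₃ x₄ : Multiset α, p = x₁ + x₂ ∧ q = x₃ + x₄ ∧ p' = x₁ + x₃ ∧ q' = x₂ + x₄ := by
  classical
  refine ⟨p ∩ p', p - p', p' - p, q - (p' - p), ?_, ?_, ?_, ?_⟩ <;>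
  · ext a
    have := congrArg (Multiset.count a) h
    simp only [Multiset.count_add, Multiset.count_inter, Multiset.count_sub] at this ⊢
    omega

/-- Source of cancellation. In a common refinement the letter a occupies two blocks with equal sum.
After removal of their overlap `x₁`, the leftovers `x₂` and `x₃` still have equal sum, hence a
common refinement, which repairs the two remaining words. -/
theorem Sim.of_cons (hE : HasRDP E) {a : E} {s t : Multiset E} (h : Sim (a ::ₘ s) (a ::ₘ t)) :
    Sim s t := by
  obtain ⟨r, h1, h2⟩ := h
  obtain ⟨p, q, hp, hq, rfl⟩ := ref_cons_iff.1 h1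
  obtain ⟨p', q', hp', hq', e⟩ := ref_cons_iff.1 h2
  obtain ⟨x₁, x₂, x₃, x₄, rfl, rfl, rfl, rfl⟩ := exists_multiset_refinement e
  obtain ⟨b, m, hb, hm, hs⟩ := mSum_add_iff.1 hp
  obtain ⟨b', m', hb', hm', hs'⟩ := mSum_add_iff.1 hp'
  obtain rfl := mSum_unique hb hb'
  obtain rfl := isSum_cancel hs hs'
  obtain ⟨y, hy, hy'⟩ := hm.exists_common_ref hE hm'
  exact ⟨y + x₄, hq.trans (hy'.add (Ref.refl _)), hq'.trans (hy.add (Ref.refl _))⟩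

theorem sim_singleton_iff {a : E} {s : Multiset E} : Sim s {a} ↔ ∃ r, Ref s r ∧ MSum r a := by
  simp only [Sim, ref_singleton_iff]

variable (E) in
/-- The congruence of similarity on the free commutative monoid over `E`. -/
def wordCon (hE : HasRDP E) : AddCon (Multiset E) where
  r := Sim
  iseqv := by
    refine ⟨fun s => ⟨s, Ref.refl s, Ref.refl s⟩, fun ⟨r, h, h'⟩ => ⟨r, h', h⟩, ?_⟩
    rintro s t w ⟨r, h1, h2⟩ ⟨r', h1', h2'⟩
    -- Confluence at the middle word gives transitivity.
    obtain ⟨q, hq, hq'⟩ := h2.confluent hE h1'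
    exact ⟨q, h1.trans hq, h2'.trans hq'⟩
  add' := by
    rintro s t s' t' ⟨r, h1, h2⟩ ⟨r', h1', h2'⟩
    exact ⟨r + r', h1.add h1', h2.add h2'⟩

end Words

/-! ### Embedding of an effect algebra with RDP into a unital po-group. -/

/-- A cancellative commutative monoid without nontrivial units is the positive cone of a
po-group consisting of differences of its elements. -/
theorem exists_group_with_cone (M : Type w) [AddCommMonoid M] [IsCancelAdd M]
    (h0 : ∀ a b : M, a + b = 0 → a = 0) :
    ∃ (G : Type w) (_ : AddCommGroup G) (_ : PartialOrder G) (_ : IsOrderedAddMonoid G)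
      (j : M →+ G), Function.Injective j ∧ (∀ g : G, 0 ≤ g ↔ ∃ a, j a = g) ∧
        ∀ g : G, ∃ a b, g = j a - j b := by
  let G := Algebra.GrothendieckAddGroup M
  let j : M →+ G := Algebra.GrothendieckAddGroup.of
  have hj : Function.Injective j := Algebra.GrothendieckAddGroup.of_injective
  let P : PartialOrder G :=
    { le := fun x y => ∃ a, x + j a = y
      le_refl := fun x => ⟨0, by simp⟩
      le_trans := by
        rintro x y z ⟨a, rfl⟩ ⟨b, rfl⟩
        exact ⟨a + b, by rw [map_add, add_assoc]⟩
      le_antisymm := by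
        rintro x y ⟨a, rfl⟩ ⟨b, h⟩
        have : j (a + b) = j 0 := by
          rw [add_assoc, ← map_add] at h
          simpa using h
        rw [h0 a b (hj this)]
        simp }
  refine ⟨G, inferInstance, P, IsOrderedAddMonoid.mk (fun x y ⟨a, h⟩ z => ⟨a, by rw [← h]; abel⟩)
    (fun x y ⟨a, h⟩ z => ⟨a, by rw [← h]; abel⟩), j, hj, ?_, ?_⟩
  · intro g
    constructor
    · rintro ⟨a, h⟩
      exact ⟨a, by rw [← h, zero_add]⟩
    · rintro ⟨a, h⟩
      exact ⟨a, by rw [h, zero_add]⟩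
  · intro g
    obtain ⟨⟨a, b⟩, h⟩ := (AddLocalization.addMonoidOf (⊤ : AddSubmonoid M)).surj g
    exact ⟨a, b, eq_sub_of_add_eq h⟩

/-- `φ` identifies the effect algebra `E` with the interval `Γ(K, φ 1)` of a unital po-group `K`
with RDP. -/
structure IsAmbient {E K : Type*} [EffectAlgebra E] [AddCommGroup K] [PartialOrder K]
    (φ : E → K) : Prop where
  injective : Function.Injective φ
  isSum_iff : ∀ {a b c}, IsSum a b c ↔ φ a + φ b = φ c
  exists_iff : ∀ {k}, (∃ a, φ a = k) ↔ 0 ≤ k ∧ k ≤ φ 1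
  isStrongUnit : IsStrongUnit (φ 1)
  hasRDP : GroupHasRDP K

/-- An effect algebra with RDP is an interval of a unital po-group with RDP. -/
theorem exists_isAmbient {E : Type w} [EffectAlgebra E] (hE : HasRDP E) :
    ∃ (K : Type w) (_ : AddCommGroup K) (_ : PartialOrder K) (_ : IsOrderedAddMonoid K)
      (φ : E → K), IsAmbient φ := by
  let M := (wordCon E hE).Quotient
  let m : Multiset E →+ M := (wordCon E hE).mk'
  have hm : Function.Surjective m := (wordCon E hE).mk'_surjective
  have meq : ∀ {s t}, m s = m t ↔ Sim s t := fun {s t} => (wordCon E hE).eq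
  have hcancel : IsCancelAdd M := by
    have : IsLeftCancelAdd M := ⟨fun x y z h => by
      obtain ⟨s, rfl⟩ := hm x
      obtain ⟨t, rfl⟩ := hm y
      obtain ⟨r, rfl⟩ := hm z
      change m s + m t = m s + m r at h
      rw [← map_add, ← map_add] at h
      induction s using Multiset.induction_on with
      | empty => simpa using h
      | cons a s ih =>
        rw [Multiset.cons_add, Multiset.cons_add] at h
        exact ih (meq.2 ((meq.1 h).of_cons hE))⟩
    exact AddCommMagma.IsLeftCancelAdd.toIsCancelAdd M
  have hzero : ∀ a b : M, a + b = 0 → a = 0 := by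
    intro x y h
    obtain ⟨s, rfl⟩ := hm x
    obtain ⟨t, rfl⟩ := hm y
    rw [← map_add, ← map_zero m] at h
    obtain ⟨r, h1, h2⟩ := meq.1 h
    rw [ref_zero_iff.1 h2] at h1
    obtain ⟨t₁, t₂, h₁, h₂, e⟩ := ref_add_iff.1 h1
    rw [← map_zero m]
    refine meq.2 ⟨0, ?_, Ref.zero⟩
    rwa [(add_eq_zero.1 e.symm).1] at h₁
  obtain ⟨K, i1, i2, i3, j, hj, hpos, hdiff⟩ := exists_group_with_cone M hzero
  have hsum : ∀ {a b c : E}, IsSum a b c ↔ j (m {a}) + j (m {b}) = j (m {c}) := by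
    intro a b c
    rw [← map_add, ← map_add, hj.eq_iff, meq, sim_singleton_iff]
    constructor
    · intro h
      exact ⟨{a} + {b}, Ref.refl _, mSum_add_iff.2
        ⟨a, b, mSum_singleton_iff.2 rfl, mSum_singleton_iff.2 rfl, h⟩⟩
    -- A refinement of the word {a, b} that sums to c consists of a block with sum a and a block
    -- with sum b.
    · rintro ⟨r, h1, h2⟩
      obtain ⟨p, q, hp, hq, rfl⟩ := ref_add_iff.1 h1
      obtain ⟨a', b', ha, hb, h⟩ := mSum_add_iff.1 h2
      obtain rfl := mSum_unique ha (ref_singleton_iff.1 hp)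
      obtain rfl := mSum_unique hb (ref_singleton_iff.1 hq)
      exact h
  have hle : ∀ a : E, j (m {a}) ≤ j (m {1}) := by
    intro a
    rw [← hsum.1 (isSum_compl a)]
    exact le_add_of_nonneg_right ((hpos _).2 ⟨_, rfl⟩)
  refine ⟨K, i1, i2, i3, fun a => j (m {a}), ?_, hsum, @fun k => ?_, ⟨?_, ?_⟩, ?_⟩
  · intro a b h
    obtain ⟨r, h1, h2⟩ := sim_singleton_iff.1 (meq.1 (hj h))
    exact mSum_unique (ref_singleton_iff.1 h1) h2
  · constructor
    · rintro ⟨a, rfl⟩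
      exact ⟨(hpos _).2 ⟨_, rfl⟩, hle a⟩
    · rintro ⟨h, h'⟩
      obtain ⟨x, rfl⟩ := (hpos _).1 h
      obtain ⟨y, hy⟩ := (hpos _).1 (sub_nonneg.2 h')
      obtain ⟨s, rfl⟩ := hm x
      obtain ⟨t, rfl⟩ := hm y
      rw [eq_sub_iff_add_eq', ← map_add, ← map_add, hj.eq_iff, meq, sim_singleton_iff] at hy
      -- The word s + t has a refinement with sum 1, so its part over s has a defined sum a, and s
      -- is similar to {a}.
      obtain ⟨r, h1, h2⟩ := hy
      obtain ⟨p, q, hp, hq, rfl⟩ := ref_add_iff.1 h1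
      obtain ⟨a, b, ha, hb, h⟩ := mSum_add_iff.1 h2
      exact ⟨a, congrArg j (meq.2 ⟨p, ref_singleton_iff.2 ha, hp⟩)⟩
  · exact (hpos _).2 ⟨_, rfl⟩
  · intro g
    obtain ⟨x, y, rfl⟩ := hdiff g
    obtain ⟨s, rfl⟩ := hm x
    have key : ∀ s : Multiset E, ∃ n : ℕ, j (m s) ≤ n • j (m {1}) := by
      intro s
      induction s using Multiset.induction_on with
      | empty => exact ⟨0, by simp⟩
      | cons a s ih =>
        obtain ⟨n, hn⟩ := ih
        refine ⟨n + 1, ?_⟩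
        rw [← Multiset.singleton_add, map_add, map_add, succ_nsmul']
        exact add_le_add (hle a) hn
    obtain ⟨n, hn⟩ := key s
    exact ⟨n, (sub_le_self _ ((hpos _).2 ⟨_, rfl⟩)).trans hn⟩
  · intro a₁ a₂ b₁ b₂ ha₁ ha₂ hb₁ hb₂ h
    obtain ⟨x₁, rfl⟩ := (hpos _).1 ha₁
    obtain ⟨x₂, rfl⟩ := (hpos _).1 ha₂
    obtain ⟨y₁, rfl⟩ := (hpos _).1 hb₁
    obtain ⟨y₂, rfl⟩ := (hpos _).1 hb₂
    obtain ⟨s₁, rfl⟩ := hm x₁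
    obtain ⟨s₂, rfl⟩ := hm x₂
    obtain ⟨t₁, rfl⟩ := hm y₁
    obtain ⟨t₂, rfl⟩ := hm y₂
    rw [← map_add, ← map_add, ← map_add, ← map_add, hj.eq_iff, meq] at h
    obtain ⟨r, h1, h2⟩ := h
    obtain ⟨p₁, p₂, hp₁, hp₂, rfl⟩ := ref_add_iff.1 h1
    obtain ⟨q₁, q₂, hq₁, hq₂, e⟩ := ref_add_iff.1 h2
    obtain ⟨c₁, c₂, c₃, c₄, rfl, rfl, rfl, rfl⟩ := exists_multiset_refinement e
    have key : ∀ {s p q : Multiset E}, Ref s (p + q) → j (m s) = j (m p) + j (m q) :=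
      fun {s p q} h => by
        rw [← map_add, ← map_add]
        exact congrArg j (meq.2 ⟨_, h, Ref.refl _⟩)
    exact ⟨j (m c₁), j (m c₂), j (m c₃), j (m c₄), (hpos _).2 ⟨_, rfl⟩, (hpos _).2 ⟨_, rfl⟩,
      (hpos _).2 ⟨_, rfl⟩, (hpos _).2 ⟨_, rfl⟩, key hp₁, key hp₂, key hq₁, key hq₂⟩

/-! ### Simple po-groups with RDP. -/

section SimpleGroups

variable {H : Type*} [AddCommGroup H] [PartialOrder H] [IsOrderedAddMonoid H]

/-- In a simple po-group, a nonzero convex submonoid of the positive cone is the whole cone. -/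
theorem IsSimplePoGroup.mem_of_nonneg (hH : IsSimplePoGroup H) (P : AddSubmonoid H)
    (hpos : ∀ p ∈ P, 0 ≤ p) (hdown : ∀ p ∈ P, ∀ x, 0 ≤ x → x ≤ p → x ∈ P)
    {p : H} (hp : p ∈ P) (hp0 : p ≠ 0) {h : H} (hh : 0 ≤ h) : h ∈ P := by
  let K : AddSubgroup H :=
    { carrier := {x | ∃ a ∈ P, ∃ b ∈ P, x = a - b}
      zero_mem' := ⟨0, P.zero_mem, 0, P.zero_mem, (sub_zero 0).symm⟩
      add_mem' := by
        rintro _ _ ⟨a, ha, b, hb, rfl⟩ ⟨c, hc, d, hd, rfl⟩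
        exact ⟨a + c, P.add_mem ha hc, b + d, P.add_mem hb hd, by abel⟩
      neg_mem' := by
        rintro _ ⟨a, ha, b, hb, rfl⟩
        exact ⟨b, hb, a, ha, by abel⟩ }
  have hPK : ∀ a ∈ P, a ∈ K := fun a ha => ⟨a, ha, 0, P.zero_mem, (sub_zero a).symm⟩
  have hK : IsOIdeal K := by
    refine ⟨⟨?_, ?_⟩, ⟨?_⟩⟩
    · rintro _ ⟨a, ha, b, hb, rfl⟩ _ ⟨c, hc, d, hd, rfl⟩
      refine ⟨a + c, hPK _ (P.add_mem ha hc), ?_, ?_⟩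
      · exact (sub_le_self _ (hpos b hb)).trans (le_add_of_nonneg_right (hpos c hc))
      · exact (sub_le_self _ (hpos d hd)).trans (le_add_of_nonneg_left (hpos a ha))
    · rintro _ ⟨a, ha, b, hb, rfl⟩ _ ⟨c, hc, d, hd, rfl⟩
      refine ⟨-(b + d), K.neg_mem (hPK _ (P.add_mem hb hd)), ?_, ?_⟩
      · change -(b + d) ≤ a - b
        have := add_nonneg (hpos a ha) (hpos d hd)
        rw [← sub_nonneg]
        convert this using 1
        abel
      · change -(b + d) ≤ c - d
        have := add_nonneg (hpos b hb) (hpos c hc)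
        rw [← sub_nonneg]
        convert this using 1
        abel
    · rintro _ ⟨a, ha, b, hb, rfl⟩ _ ⟨c, hc, d, hd, rfl⟩ x ⟨h1, h2⟩
      -- Shifting x by the lower bound gives an element between 0 and c + b, where convexity of P
      -- applies.
      have hx : x - (a - b) ∈ P := by
        refine hdown _ (P.add_mem hc hb) _ (sub_nonneg.2 h1) ?_
        have h3 : x ≤ c := h2.trans (sub_le_self _ (hpos d hd))
        calc x - (a - b) = x + b - a := by abel
          _ ≤ x + b := sub_le_self _ (hpos a ha)
          _ ≤ c + b := by gcongr
      have := K.add_mem (hPK _ hx) (K.sub_mem (hPK a ha) (hPK b hb))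
      rwa [sub_add_cancel] at this
  rcases hH.2 K hK with h' | h'
  · have : p ∈ K := hPK p hp
    rw [h'] at this
    exact absurd this hp0
  · have : h ∈ K := by rw [h']; trivial
    obtain ⟨a, ha, b, hb, rfl⟩ := this
    exact hdown a ha _ hh (sub_le_self _ (hpos b hb))

theorem GroupHasRDP.le_add (hH : GroupHasRDP H) {x a b : H} (hx : 0 ≤ x) (ha : 0 ≤ a)
    (hb : 0 ≤ b) (h : x ≤ a + b) : ∃ y z, 0 ≤ y ∧ y ≤ a ∧ 0 ≤ z ∧ z ≤ b ∧ x = y + z := by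
  obtain ⟨c₁, c₂, c₃, c₄, h1, h2, h3, h4, e1, e2, e3, e4⟩ :=
    hH x (a + b - x) a b hx (sub_nonneg.2 h) ha hb (add_sub_cancel _ _)
  exact ⟨c₁, c₂, h1, e3 ▸ le_add_of_nonneg_right h3, h2, e4 ▸ le_add_of_nonneg_right h4, e1⟩

/-- The equality (y₁ - x₁) + (y₂ - x₂) = (y₁ - x₂) + (y₂ - x₁) is decomposed; adding the entry `c₂`
to `x₁` gives the interpolant. -/
theorem GroupHasRDP.interpolation (hH : GroupHasRDP H) {x₁ x₂ y₁ y₂ : H} (h11 : x₁ ≤ y₁)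
    (h12 : x₁ ≤ y₂) (h21 : x₂ ≤ y₁) (h22 : x₂ ≤ y₂) :
    ∃ z, x₁ ≤ z ∧ x₂ ≤ z ∧ z ≤ y₁ ∧ z ≤ y₂ := by
  obtain ⟨c₁, c₂, c₃, c₄, h1, h2, h3, h4, e1, e2, e3, e4⟩ :=
    hH (y₁ - x₁) (y₂ - x₂) (y₁ - x₂) (y₂ - x₁) (sub_nonneg.2 h11) (sub_nonneg.2 h22)
      (sub_nonneg.2 h21) (sub_nonneg.2 h12) (by abel)
  refine ⟨x₁ + c₂, le_add_of_nonneg_right h2, ?_, ?_, ?_⟩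
  · have : x₁ + c₂ = x₂ + c₃ := by
      have e : y₁ = x₁ + (c₁ + c₂) := by rw [← e1]; abel
      have e' : y₁ = x₂ + (c₁ + c₃) := by rw [← e3]; abel
      have := e.symm.trans e'
      rw [add_left_comm x₁, add_left_comm x₂] at this
      exact add_left_cancel this
    rw [this]
    exact le_add_of_nonneg_right h3
  · rw [← le_sub_iff_add_le', e1]
    exact le_add_of_nonneg_left h1
  · rw [← le_sub_iff_add_le', e4]
    exact le_add_of_nonneg_right h4

/-- In a po-group with RDP, the submonoid generated by a down-closed set of positive elements is
convex. -/
theorem GroupHasRDP.closure_down (hH : GroupHasRDP H) {T : Set H} (hpos : ∀ t ∈ T, 0 ≤ t)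
    (hdown : ∀ t ∈ T, ∀ x, 0 ≤ x → x ≤ t → x ∈ T) :
    (∀ p ∈ AddSubmonoid.closure T, 0 ≤ p) ∧
      ∀ p ∈ AddSubmonoid.closure T, ∀ x, 0 ≤ x → x ≤ p → x ∈ AddSubmonoid.closure T := by
  have hp : ∀ p ∈ AddSubmonoid.closure T, 0 ≤ p := by
    intro p hp
    induction hp using AddSubmonoid.closure_induction with
    | mem x hx => exact hpos x hx
    | zero => exact le_rfl
    | add x y _ _ hx hy => exact add_nonneg hx hy
  refine ⟨hp, fun p hp' => ?_⟩
  induction hp' using AddSubmonoid.closure_induction with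
  | mem t ht => exact fun x hx hxt => AddSubmonoid.subset_closure (hdown t ht x hx hxt)
  | zero =>
    intro x hx hx'
    rw [le_antisymm hx' hx]
    exact zero_mem _
  | add a b ha hb iha ihb =>
    intro x hx hx'
    obtain ⟨y, z, hy, hy', hz, hz', rfl⟩ := hH.le_add hx (hp a ha) (hp b hb) hx'
    exact add_mem (iha y hy hy') (ihb z hz hz')

/-- In a simple po-group with RDP, a nonzero subset of `[0, u]` that is down-closed and closed
under those sums that lie in `[0, u]` contains `u`. -/
theorem IsSimplePoGroup.top_mem (hH : IsSimplePoGroup H) (hR : GroupHasRDP H) {u : H}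
    (hu : 0 ≤ u) {T : Set H} (hpos : ∀ t ∈ T, 0 ≤ t)
    (hdown : ∀ t ∈ T, ∀ x, 0 ≤ x → x ≤ t → x ∈ T)
    (hadd : ∀ s ∈ T, ∀ t ∈ T, s + t ≤ u → s + t ∈ T) {t : H} (ht : t ∈ T) (ht0 : t ≠ 0) :
    u ∈ T := by
  obtain ⟨h1, h2⟩ := hR.closure_down hpos hdown
  have hmem := hH.mem_of_nonneg (AddSubmonoid.closure T) h1 h2
    (AddSubmonoid.subset_closure ht) ht0 hu
  have key : ∀ p ∈ AddSubmonoid.closure T, p ≤ u → p ∈ T := by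
    intro p hp
    induction hp using AddSubmonoid.closure_induction with
    | mem x hx => exact fun _ => hx
    | zero => exact fun _ => hdown t ht 0 le_rfl (hpos t ht)
    | add a b ha hb iha ihb =>
      intro h
      exact hadd a (iha ((le_add_of_nonneg_right (h1 b hb)).trans h)) b
        (ihb ((le_add_of_nonneg_left (h1 a ha)).trans h)) h
  exact key u hmem le_rfl

/-- In a simple po-group with RDP, two positive elements with infimum `0` are not both nonzero. -/
theorem IsSimplePoGroup.eq_zero_of_isGLB (hH : IsSimplePoGroup H) (hR : GroupHasRDP H) {a b : H}
    (h : IsGLB {a, b} 0) : a = 0 ∨ b = 0 := by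
  have ha : 0 ≤ a := h.1 (by simp)
  have hb : 0 ≤ b := h.1 (by simp)
  -- The polar of b, that is, the positive elements with infimum 0 with b.
  let P : AddSubmonoid H :=
    { carrier := {x | 0 ≤ x ∧ ∀ y, y ≤ x → y ≤ b → y ≤ 0}
      zero_mem' := ⟨le_rfl, fun y hy _ => hy⟩
      add_mem' := by
        rintro x x' ⟨hx, h1⟩ ⟨hx', h1'⟩
        refine ⟨add_nonneg hx hx', fun y hy hy' => ?_⟩
        -- RDP splits only positive elements, so the common lower bound y is first raised to some z
        -- ≥ 0.
        obtain ⟨z, hz, hz', h2, h3⟩ := hR.interpolation (add_nonneg hx hx') hb hy hy'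
        obtain ⟨p, q, hp, hp', hq, hq', rfl⟩ := hR.le_add hz hx hx' h2
        have e := h1 p hp' ((le_add_of_nonneg_right hq).trans h3)
        have e' := h1' q hq' ((le_add_of_nonneg_left hp).trans h3)
        exact hz'.trans (add_nonpos e e') }
  by_cases ha0 : a = 0
  · exact Or.inl ha0
  have haP : a ∈ P := ⟨ha, fun y h1 h2 => h.2 (by simp [lowerBounds, h1, h2])⟩
  have hbP : b ∈ P := hH.mem_of_nonneg P (fun p hp => hp.1)
    (fun p hp x hx hxp => ⟨hx, fun y h1 h2 => hp.2 y (h1.trans hxp) h2⟩) haP ha0 hb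
  exact Or.inr (le_antisymm (hbP.2 b le_rfl le_rfl) hb)

/-- Translation moves an infimum to 0, where one of the two elements must vanish; a supremum c is
reduced to the infimum of c - a and c - b. -/
theorem IsSimplePoGroup.isAntilattice (hH : IsSimplePoGroup H) (hR : GroupHasRDP H) :
    IsAntilattice H := by
  rintro a b (⟨c, hc⟩ | ⟨c, hc⟩)
  · have hac : c ≤ a := hc.1 (by simp)
    have hbc : c ≤ b := hc.1 (by simp)
    have : IsGLB {a - c, b - c} 0 := by
      refine ⟨by simp [lowerBounds, hac, hbc], fun y hy => ?_⟩
      have h1 : y + c ≤ a := le_sub_iff_add_le.1 (hy (by simp))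
      have h2 : y + c ≤ b := le_sub_iff_add_le.1 (hy (by simp))
      have h3 : y + c ≤ c := hc.2 (by simp [lowerBounds, h1, h2])
      simpa using h3
    rcases hH.eq_zero_of_isGLB hR this with h | h
    · exact Or.inl ((sub_eq_zero.1 h).trans_le hbc)
    · exact Or.inr ((sub_eq_zero.1 h).trans_le hac)
  · have hac : a ≤ c := hc.1 (by simp)
    have hbc : b ≤ c := hc.1 (by simp)
    have : IsGLB {c - a, c - b} 0 := by
      refine ⟨by simp [lowerBounds, hac, hbc], fun y hy => ?_⟩
      have h1 : a ≤ c - y := le_sub_comm.1 (hy (by simp))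
      have h2 : b ≤ c - y := le_sub_comm.1 (hy (by simp))
      have h3 : c ≤ c - y := hc.2 (by simp [upperBounds, h1, h2])
      simpa using h3
    rcases hH.eq_zero_of_isGLB hR this with h | h
    · exact Or.inr (hbc.trans_eq (sub_eq_zero.1 h))
    · exact Or.inl (hac.trans_eq (sub_eq_zero.1 h))

theorem coe_eq_nsmul_of_isMultiple {u : H} {hu : 0 ≤ u} {n : ℕ} {a b : Gam u hu}
    (h : IsMultiple n a b) : b.1 = n • a.1 := by
  induction n generalizing b with
  | zero =>
    rw [zero_nsmul, show b = 0 from h]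
    rfl
  | succ n ih =>
    obtain ⟨c, hc, hs⟩ := h
    rw [succ_nsmul, ← ih hc]
    exact hs.symm

theorem isMultiple_zero {E : Type*} [EffectAlgebra E] (n : ℕ) : IsMultiple n (0 : E) 0 := by
  induction n with
  | zero => rfl
  | succ n ih => exact ⟨0, ih, zero_isSum 0⟩

/-- For a ≠ 0 the positive elements below multiples of a form the whole cone, so u ≤ na for some n.
If a is infinitesimal, then (n + 1)a ≤ u ≤ na, whence a ≤ 0. -/
theorem IsSimplePoGroup.isArchimedean (hH : IsSimplePoGroup H) {u : H} (hu : 0 ≤ u) :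
    IsArchimedean (Gam u hu) := by
  ext a
  constructor
  · intro ha
    by_contra hne
    have ha0 : 0 ≤ a.1 := a.2.1
    have hne : a.1 ≠ 0 := fun h => hne (Subtype.ext h)
    let P : AddSubmonoid H :=
      { carrier := {x | 0 ≤ x ∧ ∃ n : ℕ, x ≤ n • a.1}
        zero_mem' := ⟨le_rfl, 0, by simp⟩
        add_mem' := by
          rintro x y ⟨hx, n, hn⟩ ⟨hy, m, hm⟩
          exact ⟨add_nonneg hx hy, n + m, by rw [add_nsmul]; exact add_le_add hn hm⟩ }
    have hdown : ∀ p ∈ P, ∀ x, 0 ≤ x → x ≤ p → x ∈ P := by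
      rintro p ⟨-, n, hn⟩ x hx hxp
      exact ⟨hx, n, hxp.trans hn⟩
    have haP : a.1 ∈ P := ⟨ha0, 1, (one_nsmul a.1).ge⟩
    obtain ⟨-, n, hn⟩ := hH.mem_of_nonneg P (fun p hp => hp.1) hdown haP hne hu
    obtain ⟨b, hb⟩ := ha (n + 1) (by omega)
    have h1 : (n + 1) • a.1 ≤ u := coe_eq_nsmul_of_isMultiple hb ▸ b.2.2
    have h2 := h1.trans hn
    rw [succ_nsmul, add_le_iff_nonpos_right] at h2
    exact hne (le_antisymm h2 ha0)
  · rintro rfl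
    exact fun n _ => ⟨0, isMultiple_zero n⟩

end SimpleGroups

/-! ### Order and isomorphisms of interval effect algebras. -/

theorem compl_compl' {E : Type*} [EffectAlgebra E] (a : E) : compl (compl a) = a :=
  (eq_compl (isSum_comm (isSum_compl a))).symm

theorem le_one' {E : Type*} [EffectAlgebra E] (a : E) : Le a 1 := ⟨compl a, isSum_compl a⟩

theorem Gam.le_iff {H : Type*} [AddCommGroup H] [PartialOrder H] [IsOrderedAddMonoid H] {u : H}
    {hu : 0 ≤ u} {a b : Gam u hu} : Le a b ↔ a.1 ≤ b.1 := by
  constructor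
  · rintro ⟨c, h⟩
    have h : a.1 + c.1 = b.1 := h
    rw [← h]
    exact le_add_of_nonneg_right c.2.1
  · intro h
    exact ⟨⟨b.1 - a.1, sub_nonneg.2 h, (sub_le_self _ a.2.1).trans b.2.2⟩,
      add_sub_cancel a.1 b.1⟩

theorem IsHom.isSum_iff {E F : Type*} [EffectAlgebra E] [EffectAlgebra F] {f : E ≃ F}
    (hf : IsHom f) (hf' : IsHom f.symm) {a b c : E} : IsSum (f a) (f b) (f c) ↔ IsSum a b c :=
  ⟨fun h => by simpa using hf'.map_sum h, hf.map_sum⟩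

theorem IsHom.le_iff {E F : Type*} [EffectAlgebra E] [EffectAlgebra F] {f : E ≃ F}
    (hf : IsHom f) (hf' : IsHom f.symm) {a b : E} : Le (f a) (f b) ↔ Le a b := by
  constructor
  · rintro ⟨c, h⟩
    refine ⟨f.symm c, (hf.isSum_iff hf').1 ?_⟩
    simpa using h
  · rintro ⟨c, h⟩
    exact ⟨f c, hf.map_sum h⟩

/-! ### The strong decomposition of a lexicographic interval. -/

section Lexicographic

variable {E H G : Type*} [EffectAlgebra E] [AddCommGroup H] [PartialOrder H]
  [IsOrderedAddMonoid H] [AddCommGroup G] [PartialOrder G] [IsOrderedAddMonoid G]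

/-- For 0 < t < u the fibre over t is a full copy of G, and the lexicographic order ranks the
fibres. Only the two end fibres are truncated, and they contain 0 and 1. -/
theorem isStrongDecomposition_of_isomorphic {u : H} (hu : 0 < u) (hG : IsDirectedGroup G)
    {f : E ≃ Gam (toLex (u, 0) : H ×ₗ G) (lex_nonneg hu.le)} (hf : IsHom f) (hf' : IsHom f.symm) :
    IsStrongDecomposition u (fun t : Set.Icc (0 : H) u => {x : E | (ofLex (f x).1).1 = t}) := by
  have hsum : ∀ {x y z : E}, IsSum x y z → (ofLex (f x).1).1 + (ofLex (f y).1).1 =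
      (ofLex (f z).1).1 := fun h => congrArg (fun w => (ofLex w).1) (hf.map_sum h)
  have hone : (ofLex (f 1).1).1 = u := by rw [hf.map_one]; rfl
  have hmem : ∀ x : E, (ofLex (f x).1).1 ∈ Set.Icc (0 : H) u := fun x =>
    ⟨Prod.Lex.monotone_fst _ _ (f x).2.1, Prod.Lex.monotone_fst _ _ (f x).2.2⟩
  have hlex : ∀ {t : H} {g g' : G}, g ≤ g' → (toLex (t, g) : H ×ₗ G) ≤ toLex (t, g') :=
    fun h => Prod.Lex.toLex_le_toLex.2 (Or.inr ⟨rfl, h⟩)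
  have heta : ∀ {x : E} {t : H}, (ofLex (f x).1).1 = t →
      (f x).1 = toLex (t, (ofLex (f x).1).2) := by
    rintro x t rfl
    rfl
  have hc : ∀ t : Set.Icc (0 : H) u, (0 : H ×ₗ G) ≤ toLex (t.1, 0) ∧
      (toLex (t.1, 0) : H ×ₗ G) ≤ toLex (u, 0) := by
    refine fun t => ⟨lex_nonneg t.2.1, ?_⟩
    rcases t.2.2.lt_or_eq with h | h
    · exact Prod.Lex.toLex_le_toLex.2 (Or.inl h)
    · exact Prod.Lex.toLex_le_toLex.2 (Or.inr ⟨h, le_rfl⟩)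
  have hcompl : ∀ x : E, (ofLex (f (compl x)).1).1 = u - (ofLex (f x).1).1 := fun x =>
    eq_sub_of_add_eq' ((hsum (isSum_compl x)).trans hone)
  have hsurj : ∀ {w : H ×ₗ G} (hw : 0 ≤ w ∧ w ≤ toLex (u, 0)), (f (f.symm ⟨w, hw⟩)).1 = w :=
    fun hw => congrArg Subtype.val (f.apply_symm_apply _)
  have hfst : ∀ {w : H ×ₗ G} (hw : 0 ≤ w ∧ w ≤ toLex (u, 0)),
      (ofLex (f (f.symm ⟨w, hw⟩)).1).1 = (ofLex w).1 :=
    fun hw => congrArg (fun w => (ofLex w).1) (hsurj hw)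
  have hle : ∀ {x y : E}, (f x).1 ≤ (f y).1 → Le x y := fun h =>
    (hf.le_iff hf').1 (Gam.le_iff.2 h)
  have hcD : ∀ t : Set.Icc (0 : H) u, (ofLex (f (f.symm ⟨toLex (t.1, 0), hc t⟩)).1).1 = t :=
    fun t => hfst (hc t)
  refine ⟨⟨fun t => ⟨_, hcD t⟩, ?_, ?_, ?_, ?_⟩, ?_, ?_,
    fun t => f.symm ⟨toLex (t.1, 0), hc t⟩, hcD, ?_, ?_⟩
  · intro s t hst
    ext x
    simp only [Set.mem_inter_iff, Set.mem_ofPred_eq, Set.mem_empty_iff_false, iff_false, not_and]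
    intro h h'
    exact hst (Subtype.ext (h.symm.trans h'))
  · ext x
    simp only [Set.mem_iUnion, Set.mem_ofPred_eq, Set.mem_univ, iff_true]
    exact ⟨⟨_, hmem x⟩, rfl⟩
  · intro t r hr
    ext y
    simp only [Set.mem_image, Set.mem_ofPred_eq, hr]
    constructor
    · rintro ⟨x, hx, rfl⟩
      rw [hcompl, hx]
    · intro hy
      exact ⟨compl y, by rw [hcompl, hy, sub_sub_cancel], compl_compl' y⟩
  · intro s t x y z hx hy h
    refine ⟨⟨_, hmem z⟩, ?_, rfl⟩
    simp only [Set.mem_ofPred_eq] at hx hy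
    rw [← hx, ← hy]
    exact (hsum h).symm
  · intro s t hst x hx y hy
    refine hle ?_
    rw [heta hx, heta hy]
    exact Prod.Lex.toLex_le_toLex.2 (Or.inl hst)
  · refine fun t => ⟨fun x hx y hy => ?_, fun x hx y hy => ?_⟩
    -- In the top fibre an upper bound taken from G may exceed (u, 0), so 1 serves instead; dually
    -- for 0 in the bottom fibre.
    · by_cases ht : t.1 = u
      · exact ⟨1, hone.trans ht.symm, le_one' x, le_one' y⟩
      · obtain ⟨g, -, hg, hg'⟩ := hG.1 (ofLex (f x).1).2 trivial (ofLex (f y).1).2 trivial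
        have h1 : (f x).1 ≤ toLex (t.1, g) := (heta hx).trans_le (hlex hg)
        have h2 : (f y).1 ≤ toLex (t.1, g) := (heta hy).trans_le (hlex hg')
        have hw : (0 : H ×ₗ G) ≤ toLex (t.1, g) ∧ (toLex (t.1, g) : H ×ₗ G) ≤ toLex (u, 0) :=
          ⟨(f x).2.1.trans h1, Prod.Lex.toLex_le_toLex.2 (Or.inl (lt_of_le_of_ne t.2.2 ht))⟩
        exact ⟨f.symm ⟨_, hw⟩, hfst hw,
          hle (h1.trans_eq (hsurj hw).symm), hle (h2.trans_eq (hsurj hw).symm)⟩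
    · by_cases ht : t.1 = 0
      · have h0 : ∀ x : E, Le 0 x := fun x => ⟨x, zero_isSum x⟩
        refine ⟨0, ?_, h0 x, h0 y⟩
        have := hsum (zero_isSum (0 : E))
        simp only [Set.mem_ofPred_eq, ht]
        simpa using this
      · obtain ⟨g, -, hg, hg'⟩ := hG.2 (ofLex (f x).1).2 trivial (ofLex (f y).1).2 trivial
        have h1 : toLex (t.1, g) ≤ (f x).1 := (hlex hg).trans_eq (heta hx).symm
        have h2 : toLex (t.1, g) ≤ (f y).1 := (hlex hg').trans_eq (heta hy).symm
        have hw : (0 : H ×ₗ G) ≤ toLex (t.1, g) ∧ (toLex (t.1, g) : H ×ₗ G) ≤ toLex (u, 0) :=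
          ⟨Prod.Lex.toLex_le_toLex.2 (Or.inl (lt_of_le_of_ne t.2.1 (Ne.symm ht))),
            h1.trans (f x).2.2⟩
        exact ⟨f.symm ⟨_, hw⟩, hfst hw,
          hle ((hsurj hw).trans_le h1), hle ((hsurj hw).trans_le h2)⟩
  · intro v t r hr
    refine hf'.map_sum ?_
    change (toLex (v.1, 0) : H ×ₗ G) + toLex (t.1, 0) = toLex (r.1, 0)
    rw [← toLex_add, Prod.mk_add_mk, add_zero, hr]
  · intro r hr
    rw [← hf'.map_one]
    refine congrArg f.symm (Subtype.ext ?_)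
    change (toLex (r.1, 0) : H ×ₗ G) = toLex (u, 0)
    rw [hr]

end Lexicographic

/-! ### Ideals and the radical of a strong perfect effect algebra. -/

section Perfect

variable {E H : Type*} [EffectAlgebra E] [AddCommGroup H] [PartialOrder H]
  {u : H} {D : Set.Icc (0 : H) u → Set E}

theorem IsDecomposition.eq_of_mem (hD : IsDecomposition u D) {s t : Set.Icc (0 : H) u} {x : E}
    (hs : x ∈ D s) (ht : x ∈ D t) : s = t := by
  by_contra h
  exact (Set.mem_empty_iff_false x).1 (hD.disjoint s t h ▸ ⟨hs, ht⟩)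

theorem IsDecomposition.exists_mem (hD : IsDecomposition u D) (x : E) : ∃ t, x ∈ D t :=
  Set.mem_iUnion.1 (hD.cover ▸ Set.mem_univ x)

theorem IsDecomposition.add_eq (hD : IsDecomposition u D) {s t r : Set.Icc (0 : H) u} {x y z : E}
    (hx : x ∈ D s) (hy : y ∈ D t) (hz : z ∈ D r) (h : IsSum x y z) : (s : H) + t = r := by
  obtain ⟨r', hr, hz'⟩ := hD.sum_mem s t x y z hx hy h
  rw [hD.eq_of_mem hz hz', hr]

variable [IsOrderedAddMonoid H]

theorem IsDecomposition.isIdeal (hD : IsDecomposition u D) {o : Set.Icc (0 : H) u}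
    (ho : (o : H) = 0) : IsIdeal (D o) where
  nonempty := hD.nonempty o
  down := by
    rintro a b ⟨c, h⟩ hb
    obtain ⟨s, hs⟩ := hD.exists_mem a
    obtain ⟨t, ht⟩ := hD.exists_mem c
    have e := hD.add_eq hs ht hb h
    rw [ho] at e
    have : s = o := Subtype.ext (by
      rw [ho]
      exact le_antisymm ((le_add_of_nonneg_right t.2.1).trans_eq e) s.2.1)
    rwa [← this]
  add := by
    intro a b c ha hb h
    obtain ⟨r, hr, hc⟩ := hD.sum_mem o o a b c ha hb h
    have : r = o := Subtype.ext (by rw [hr, ho, add_zero])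
    rwa [← this]

theorem IsDecomposition.mem_of_isSum (hD : IsDecomposition u D) {o t : Set.Icc (0 : H) u}
    (ho : (o : H) = 0) {x y e : E} (hx : x ∈ D t) (hy : y ∈ D t) (h : IsSum y e x) :
    e ∈ D o := by
  obtain ⟨s, hs⟩ := hD.exists_mem e
  have := hD.add_eq hy hs hx h
  have : s = o := Subtype.ext (by rw [ho]; simpa using this)
  rwa [← this]

theorem IsIdeal.eq_univ {J : Set E} (hJ : IsIdeal J) (h : (1 : E) ∈ J) : J = Set.univ :=
  Set.eq_univ_of_forall fun x => hJ.down (le_one' x) h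

/-- The indices s with c_s in J form a set to which `IsSimplePoGroup.top_mem` applies, so it
contains u, and c_u = 1. -/
theorem IsStrongDecomposition.ideal_eq_univ (hD : IsStrongDecomposition u D)
    (hH : IsSimplePoGroup H) (hR : GroupHasRDP H) {J : Set E} (hJ : IsIdeal J)
    {t : Set.Icc (0 : H) u} {x : E} (hx : x ∈ D t) (hxJ : x ∈ J) (ht : (t : H) ≠ 0) :
    J = Set.univ := by
  obtain ⟨hD, hord, hdir, c, hcD, hcadd, hc1⟩ := hD
  have hu : 0 ≤ u := t.2.1.trans t.2.2
  let o : Set.Icc (0 : H) u := ⟨0, le_rfl, hu⟩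
  have hoJ : ∀ y ∈ D o, y ∈ J := fun y hy => hJ.down
    (hord o t (Subtype.coe_lt_coe.1 (lt_of_le_of_ne t.2.1 (Ne.symm ht))) y hy x hx) hxJ
  let T : Set H := {h | ∃ s : Set.Icc (0 : H) u, (s : H) = h ∧ c s ∈ J}
  have htT : (t : H) ∈ T := by
    refine ⟨t, rfl, ?_⟩
    -- A common lower bound y of x and c_t within D_t lies in J, and c_t - y lies in D_0, which is
    -- contained in J.
    obtain ⟨y, hy, hyx, e, he⟩ := (hdir t).2 x hx (c t) (hcD t)
    exact hJ.add (hJ.down hyx hxJ) (hoJ e (hD.mem_of_isSum rfl (hcD t) hy he)) he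
  obtain ⟨s, hs, hsJ⟩ := hH.top_mem hR hu (T := T)
    (by
      rintro _ ⟨s, rfl, -⟩
      exact s.2.1)
    (by
      rintro _ ⟨s, rfl, hs⟩ h h0 hhs
      let r : Set.Icc (0 : H) u := ⟨h, h0, hhs.trans s.2.2⟩
      refine ⟨r, rfl, hJ.down ⟨_, hcadd r ⟨s.1 - h, sub_nonneg.2 hhs,
        (sub_le_self _ h0).trans s.2.2⟩ s (add_sub_cancel h s.1).symm⟩ hs⟩)
    (by
      rintro _ ⟨s, rfl, hs⟩ _ ⟨r, rfl, hr⟩ hsr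
      exact ⟨⟨s.1 + r.1, add_nonneg s.2.1 r.2.1, hsr⟩, rfl, hJ.add hs hr (hcadd _ _ _ rfl)⟩)
    htT ht
  exact hJ.eq_univ (hc1 s hs ▸ hsJ)

theorem IsStrongDecomposition.isMaximalIdeal_iff (hD : IsStrongDecomposition u D)
    (hu : 0 < u) (hH : IsSimplePoGroup H) (hR : GroupHasRDP H) {o : Set.Icc (0 : H) u}
    (ho : (o : H) = 0) {J : Set E} : IsMaximalIdeal J ↔ J = D o := by
  have hsub : ∀ J : Set E, IsIdeal J → J ≠ Set.univ → J ⊆ D o := by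
    intro J hJ hne x hx
    obtain ⟨t, ht⟩ := hD.1.exists_mem x
    by_cases h : (t : H) = 0
    · rwa [← Subtype.ext (h.trans ho.symm)]
    · exact absurd (hD.ideal_eq_univ hH hR hJ ht hx h) hne
  have hoI := hD.1.isIdeal ho
  have hone : D o ≠ Set.univ := by
    intro h
    obtain ⟨hD, -, -, c, hcD, -, hc1⟩ := hD
    let i : Set.Icc (0 : H) u := ⟨u, hu.le, le_rfl⟩
    have h1 : (1 : E) ∈ D i := hc1 i rfl ▸ hcD i
    have := hD.eq_of_mem h1 (h ▸ Set.mem_univ _)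
    exact hu.ne' ((congrArg Subtype.val this).trans ho)
  constructor
  · rintro ⟨hJ, hne, hmax⟩
    by_contra h
    exact hmax _ hoI hone ((hsub J hJ hne).ssubset_of_ne h)
  · rintro rfl
    exact ⟨hoI, hone, fun J hJ hne h => h.2 (hsub J hJ hne)⟩

/-- Two elements of one part have a common lower bound in that part, and differences within a part
lie in D_0. -/
theorem IsDecomposition.rel_iff (hD : IsDecomposition u D) (hdir : IsDirectedDec D)
    {o : Set.Icc (0 : H) u} (ho : (o : H) = 0) {s t : Set.Icc (0 : H) u} {x y : E} (hx : x ∈ D s)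
    (hy : y ∈ D t) : Rel (D o) x y ↔ s = t := by
  constructor
  · rintro ⟨e, he, f, hf, c, h1, h2⟩
    obtain ⟨r, hr⟩ := hD.exists_mem c
    have e1 := hD.add_eq he hr hx h1
    have e2 := hD.add_eq hf hr hy h2
    exact Subtype.ext (e1.symm.trans e2)
  · rintro rfl
    obtain ⟨z, hz, ⟨e, he⟩, f, hf⟩ := (hdir s).2 x hx y hy
    exact ⟨e, hD.mem_of_isSum ho hx hz he, f, hD.mem_of_isSum ho hy hz hf, z, isSum_comm he,
      isSum_comm hf⟩

theorem IsStrongDecomposition.isRetractive_isStrict (hD : IsStrongDecomposition u D)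
    {o : Set.Icc (0 : H) u} (ho : (o : H) = 0) (hE : HasRDP E) {I : Set E} (hI : IsIdeal I)
    (hIo : I = D o) : IsRetractive hE hI ∧ IsStrict hE hI := by
  subst hIo
  obtain ⟨hD, hord, hdir, c, hcD, hcadd, hc1⟩ := hD
  choose τ hτ using hD.exists_mem
  have hrel : ∀ {x y : E}, Rel (D o) x y ↔ τ x = τ y := fun {x y} =>
    hD.rel_iff hdir ho (hτ x) (hτ y)
  constructor
  -- The retraction sends the class of x to the distinguished element of the part containing x.
  · refine ⟨Quotient.lift (fun x => c (τ x)) (fun x y h => congrArg c (hrel.1 h)),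
      ⟨?_, ?_⟩, fun X => ?_⟩
    · refine hc1 _ ?_
      have h0 : (τ 1 : Set.Icc (0 : H) u).1 ≤ u := (τ (1 : E)).2.2
      let i : Set.Icc (0 : H) u := ⟨u, o.2.1.trans o.2.2, le_rfl⟩
      have h1 : (1 : E) ∈ D i := hc1 i rfl ▸ hcD i
      rw [hD.eq_of_mem (hτ 1) h1]
    · rintro _ _ _ ⟨x, y, z, rfl, rfl, rfl, h⟩
      exact hcadd _ _ _ (hD.add_eq (hτ x) (hτ y) (hτ z) h).symm
    · obtain ⟨x, rfl⟩ := proj_surj X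
      exact proj_eq.2 ((hD.rel_iff hdir ho (hcD _) (hτ x)).2 rfl)
  · rintro x y ⟨⟨_, x', z, y', hx, rfl, hy, h⟩, hne⟩
    have hne : τ x ≠ τ y := fun h => hne (proj_eq.2 (hrel.2 h))
    have hle : τ x ≤ τ y := by
      rw [← hrel.1 (proj_eq.1 hx), ← hrel.1 (proj_eq.1 hy), ← Subtype.coe_le_coe,
        ← hD.add_eq (hτ x') (hτ z) (hτ y') h]
      exact le_add_of_nonneg_right (τ z).2.1
    refine ⟨hord _ _ (lt_of_le_of_ne hle hne) x (hτ x) y (hτ y), ?_⟩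
    rintro rfl
    exact hne rfl

theorem IsStrongDecomposition.isLocal_isRetractive_isStrict (hD : IsStrongDecomposition u D)
    (hu : 0 < u) (hH : IsSimplePoGroup H) (hR : GroupHasRDP H) (hE : HasRDP E) :
    IsLocal E ∧ IsRetractive hE (isIdeal_rad E) ∧ IsStrict hE (isIdeal_rad E) := by
  let o : Set.Icc (0 : H) u := ⟨0, le_rfl, hu.le⟩
  have hmax : ∀ {J : Set E}, IsMaximalIdeal J ↔ J = D o := hD.isMaximalIdeal_iff hu hH hR rfl
  refine ⟨⟨D o, hmax.2 rfl, fun J hJ => hmax.1 hJ⟩, ?_⟩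
  refine hD.isRetractive_isStrict (o := o) rfl hE (isIdeal_rad E) ?_
  simp [Rad, hmax]

end Perfect

/-! ### Transfer of ideals and simplicity to the ambient group. -/

theorem exists_isSum_of_le_compl {E : Type*} [EffectAlgebra E] {a b : E} (h : Le a (compl b)) :
    ∃ c, IsSum a b c := by
  obtain ⟨r, hr⟩ := h
  obtain ⟨c, hc, -⟩ := assoc_left hr (isSum_compl b)
  exact ⟨c, isSum_comm hc⟩

theorem zero_le' {E : Type*} [EffectAlgebra E] (a : E) : Le 0 a := ⟨a, zero_isSum a⟩

section Ambient

variable {E K : Type*} [EffectAlgebra E] [AddCommGroup K] [PartialOrder K] {φ : E → K}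

theorem IsAmbient.map_zero (h : IsAmbient φ) : φ 0 = 0 := by
  simpa using h.isSum_iff.1 (zero_isSum (0 : E))

theorem IsAmbient.nonneg (h : IsAmbient φ) (a : E) : 0 ≤ φ a := (h.exists_iff.1 ⟨a, rfl⟩).1

theorem IsAmbient.le_map_one (h : IsAmbient φ) (a : E) : φ a ≤ φ 1 :=
  (h.exists_iff.1 ⟨a, rfl⟩).2

/-- The subgroup of differences of elements of an ideal in which all sums are defined. -/
def IsAmbient.idealSubgroup (h : IsAmbient φ) {I : Set E} (hI : IsIdeal I)
    (hadd : ∀ a ∈ I, ∀ b ∈ I, ∃ c, IsSum a b c) : AddSubgroup K where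
  carrier := {k | ∃ a ∈ I, ∃ b ∈ I, k = φ a - φ b}
  zero_mem' := ⟨0, hI.zero_mem, 0, hI.zero_mem, (sub_self _).symm⟩
  add_mem' := by
    rintro _ _ ⟨a, ha, b, hb, rfl⟩ ⟨a', ha', b', hb', rfl⟩
    obtain ⟨c, hc⟩ := hadd a ha a' ha'
    obtain ⟨d, hd⟩ := hadd b hb b' hb'
    refine ⟨c, hI.add ha ha' hc, d, hI.add hb hb' hd, ?_⟩
    rw [← h.isSum_iff.1 hc, ← h.isSum_iff.1 hd]
    abel
  neg_mem' := by
    rintro _ ⟨a, ha, b, hb, rfl⟩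
    exact ⟨b, hb, a, ha, neg_sub _ _⟩

theorem IsAmbient.map_mem_idealSubgroup (h : IsAmbient φ) {I : Set E} (hI : IsIdeal I)
    (hadd : ∀ a ∈ I, ∀ b ∈ I, ∃ c, IsSum a b c) {a : E} (ha : a ∈ I) :
    φ a ∈ h.idealSubgroup hI hadd :=
  ⟨a, ha, 0, hI.zero_mem, by rw [h.map_zero, sub_zero]⟩

variable [IsOrderedAddMonoid K]

theorem IsAmbient.le_iff (h : IsAmbient φ) {a b : E} : Le a b ↔ φ a ≤ φ b := by
  constructor
  · rintro ⟨c, hc⟩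
    rw [← h.isSum_iff.1 hc]
    exact le_add_of_nonneg_right (h.nonneg c)
  · intro hab
    obtain ⟨c, hc⟩ := h.exists_iff.2
      ⟨sub_nonneg.2 hab, (sub_le_self _ (h.nonneg a)).trans (h.le_map_one b)⟩
    exact ⟨c, h.isSum_iff.2 (by rw [hc, add_sub_cancel])⟩

/-- The group of a simple effect algebra with RDP is simple. -/
theorem IsAmbient.isSimplePoGroup (h : IsAmbient φ) (h01 : (1 : E) ≠ 0)
    (hE : ∀ J : Set E, IsIdeal J → J = {0} ∨ J = Set.univ) : IsSimplePoGroup K := by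
  have hu0 : φ 1 ≠ 0 := fun e => h01 (h.injective (e.trans h.map_zero.symm))
  refine ⟨⟨φ 1, 0, hu0⟩, fun L hL => ?_⟩
  have hconv : ∀ {x y : K}, y ∈ L → 0 ≤ x → x ≤ y → x ∈ L := fun hy h1 h2 =>
    hL.2.out L.zero_mem hy ⟨h1, h2⟩
  have hJ : IsIdeal {a : E | φ a ∈ L} :=
    { nonempty := ⟨0, by simp [h.map_zero]⟩
      down := fun {a b} hab hb => hconv hb (h.nonneg a) (h.le_iff.1 hab)
      add := fun {a b c} ha hb hc => by
        have := L.add_mem ha hb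
        rwa [h.isSum_iff.1 hc] at this }
  rcases hE _ hJ with hJ | hJ
  · left
    -- RDP cuts x into n summands from the interval; each lies in L by convexity and is therefore 0.
    have hpos : ∀ n : ℕ, ∀ x ∈ L, 0 ≤ x → x ≤ n • φ 1 → x = 0 := by
      intro n
      induction n with
      | zero =>
        intro x _ h0 h1
        rw [zero_nsmul] at h1
        exact le_antisymm h1 h0
      | succ n ih =>
        intro x hx h0 h1
        rw [succ_nsmul] at h1
        have hu := h.nonneg 1
        obtain ⟨y, z, hy, hy', hz, hz', rfl⟩ := h.hasRDP.le_add h0 (nsmul_nonneg hu n) hu h1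
        have hyL := hconv hx hy (le_add_of_nonneg_right hz)
        have hzL := hconv hx hz (le_add_of_nonneg_left hy)
        obtain ⟨a, rfl⟩ := h.exists_iff.2 ⟨hz, hz'⟩
        have ha : a ∈ {a : E | φ a ∈ L} := hzL
        rw [hJ] at ha
        rw [ih y hyL hy hy', show a = 0 from ha, h.map_zero, add_zero]
    refine (AddSubgroup.eq_bot_iff_forall L).2 fun x hx => ?_
    have hpos' : ∀ y ∈ L, 0 ≤ y → y = 0 := fun y hy h0 => by
      obtain ⟨n, hn⟩ := h.isStrongUnit.bound y
      exact hpos n y hy h0 hn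
    -- Directedness extends this from positive elements to all of L: an upper bound of x and 0 in L
    -- must be 0.
    obtain ⟨m, hm, hxm, h0m⟩ := hL.1.1 x hx 0 L.zero_mem
    obtain rfl := hpos' m hm h0m
    have := hpos' (-x) (L.neg_mem hx) (neg_nonneg.2 hxm)
    rwa [neg_eq_zero] at this
  · right
    have hu : φ 1 ∈ L := by
      have : (1 : E) ∈ {a : E | φ a ∈ L} := hJ ▸ Set.mem_univ _
      exact this
    refine (AddSubgroup.eq_top_iff' L).2 fun x => ?_
    obtain ⟨n, hn⟩ := h.isStrongUnit.bound x
    obtain ⟨m, hm⟩ := h.isStrongUnit.bound (-x)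
    exact hL.2.out (L.neg_mem (L.nsmul_mem hu m)) (L.nsmul_mem hu n) ⟨neg_le.1 hm, hn⟩

/-- A positive difference of elements of I is already a difference in the effect algebra. So the
positive cone of the subgroup is the image of I. -/
theorem IsAmbient.exists_of_nonneg (h : IsAmbient φ) {I : Set E} (hI : IsIdeal I)
    (hadd : ∀ a ∈ I, ∀ b ∈ I, ∃ c, IsSum a b c) {k : K} (hk : k ∈ h.idealSubgroup hI hadd)
    (h0 : 0 ≤ k) : ∃ a ∈ I, φ a = k := by
  obtain ⟨a, ha, b, hb, rfl⟩ := hk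
  obtain ⟨c, hc⟩ := h.le_iff.2 (sub_nonneg.1 h0)
  exact ⟨c, hI.down ⟨b, isSum_comm hc⟩ ha, eq_sub_of_add_eq' (h.isSum_iff.1 hc)⟩

theorem IsAmbient.isDirectedGroup_idealSubgroup (h : IsAmbient φ) {I : Set E} (hI : IsIdeal I)
    (hadd : ∀ a ∈ I, ∀ b ∈ I, ∃ c, IsSum a b c) :
    IsDirectedGroup (h.idealSubgroup hI hadd) := by
  have hup : ∀ x y : h.idealSubgroup hI hadd, ∃ z, x ≤ z ∧ y ≤ z := by
    rintro ⟨_, a, ha, b, hb, rfl⟩ ⟨_, a', ha', b', hb', rfl⟩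
    refine ⟨⟨φ a, h.map_mem_idealSubgroup hI hadd ha⟩ +
      ⟨φ a', h.map_mem_idealSubgroup hI hadd ha'⟩, ?_, ?_⟩
    · exact (sub_le_self _ (h.nonneg b)).trans (le_add_of_nonneg_right (h.nonneg a'))
    · exact (sub_le_self _ (h.nonneg b')).trans (le_add_of_nonneg_left (h.nonneg a))
  constructor
  · intro x _ y _
    obtain ⟨z, hx, hy⟩ := hup x y
    exact ⟨z, trivial, hx, hy⟩
  · intro x _ y _
    obtain ⟨z, hx, hy⟩ := hup (-x) (-y)
    exact ⟨-z, trivial, neg_le.1 hx, neg_le.1 hy⟩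

theorem IsAmbient.hasRDP_idealSubgroup (h : IsAmbient φ) {I : Set E} (hI : IsIdeal I)
    (hadd : ∀ a ∈ I, ∀ b ∈ I, ∃ c, IsSum a b c) :
    GroupHasRDP (h.idealSubgroup hI hadd) := by
  rintro ⟨a₁, k₁⟩ ⟨a₂, k₂⟩ ⟨b₁, l₁⟩ ⟨b₂, l₂⟩ ha₁ ha₂ hb₁ hb₂ hs
  obtain ⟨c₁, c₂, c₃, c₄, h1, h2, h3, h4, e1, e2, e3, e4⟩ :=
    h.hasRDP a₁ a₂ b₁ b₂ ha₁ ha₂ hb₁ hb₂ (congrArg Subtype.val hs)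
  have hmem : ∀ {x a : K}, a ∈ h.idealSubgroup hI hadd → 0 ≤ a → 0 ≤ x → x ≤ a →
      x ∈ h.idealSubgroup hI hadd := by
    intro x a ha h0 hx hxa
    obtain ⟨e, he, rfl⟩ := h.exists_of_nonneg hI hadd ha h0
    obtain ⟨f, rfl⟩ := h.exists_iff.2 ⟨hx, hxa.trans (h.le_map_one e)⟩
    exact h.map_mem_idealSubgroup hI hadd (hI.down (h.le_iff.2 hxa) he)
  exact ⟨⟨c₁, hmem k₁ ha₁ h1 (e1 ▸ le_add_of_nonneg_right h2)⟩,
    ⟨c₂, hmem k₁ ha₁ h2 (e1 ▸ le_add_of_nonneg_left h1)⟩,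
    ⟨c₃, hmem k₂ ha₂ h3 (e2 ▸ le_add_of_nonneg_right h4)⟩,
    ⟨c₄, hmem k₂ ha₂ h4 (e2 ▸ le_add_of_nonneg_left h3)⟩, h1, h2, h3, h4,
    Subtype.ext e1, Subtype.ext e2, Subtype.ext e3, Subtype.ext e4⟩

end Ambient

/-! ### Quotients, strictness and the lexicographic coordinates. -/

section Quotients

variable {E : Type*} [EffectAlgebra E] {hE : HasRDP E} {I : Set E} {hI : IsIdeal I}

theorem proj_isSum {x y z : E} (h : IsSum x y z) :
    IsSum (proj hE hI x) (proj hE hI y) (proj hE hI z) := ⟨x, y, z, rfl, rfl, rfl, h⟩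

theorem proj_le {x y : E} (h : Le x y) : Le (proj hE hI x) (proj hE hI y) :=
  ⟨_, proj_isSum h.choose_spec⟩

theorem proj_eq_zero_iff {x : E} : proj hE hI x = 0 ↔ x ∈ I := by
  constructor
  · intro h
    obtain ⟨e, he, f, hf, c, h1, h2⟩ := proj_eq.1 (show proj hE hI x = proj hE hI 0 from h)
    rw [eq_zero_of_isSum_zero (isSum_comm h2)] at h1
    rwa [isSum_unique h1 (isSum_zero e)]
  · exact fun h => proj_eq.2 (rel_of_isSum hI h (isSum_zero x))

theorem proj_compl_eq_one {x : E} (hx : x ∈ I) : proj hE hI (compl x) = 1 := by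
  have h := proj_isSum (hE := hE) (hI := hI) (isSum_compl x)
  rw [proj_eq_zero_iff.2 hx] at h
  exact isSum_unique (zero_isSum _) h

/-- The two representing sums differ by elements of I. Removing these from the summands leaves two
decompositions of the same element c, to which RDP of E applies. -/
theorem hasRDP_quo : HasRDP (Quo hE hI) := by
  rintro _ _ _ _ _ ⟨x₁, x₂, s, rfl, rfl, rfl, h⟩ ⟨y₁, y₂, s', rfl, rfl, hs, h'⟩
  obtain ⟨f, hf, e, he, c, h2, h1⟩ := proj_eq.1 hs
  obtain ⟨e₁, e₂, c₁, c₂, a1, a2, a3, a4⟩ := hE _ _ _ _ _ h1 h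
  obtain ⟨f₁, f₂, d₁, d₂, b1, b2, b3, b4⟩ := hE _ _ _ _ _ h2 h'
  obtain ⟨r₁, r₂, r₃, r₄, g1, g2, g3, g4⟩ := hE _ _ _ _ _ a2 b2
  have key : ∀ {e c x : E}, e ∈ I → IsSum e c x → proj hE hI x = proj hE hI c :=
    fun he h => proj_eq.2 (rel_of_isSum hI he h)
  rw [key (hI.down ⟨e₂, a1⟩ he) a3, key (hI.down ⟨e₁, isSum_comm a1⟩ he) a4,
    key (hI.down ⟨f₂, b1⟩ hf) b3, key (hI.down ⟨f₁, isSum_comm b1⟩ hf) b4]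
  exact ⟨_, _, _, _, proj_isSum g1, proj_isSum g2, proj_isSum g3, proj_isSum g4⟩

/-- The preimage of J is an ideal containing I, so by maximality it is I or everything. -/
theorem IsMaximalIdeal.quo_ideal (hmax : IsMaximalIdeal I) (J : Set (Quo hE hI))
    (hJ : IsIdeal J) : J = {0} ∨ J = Set.univ := by
  have hpre : IsIdeal {x | proj hE hI x ∈ J} :=
    { nonempty := ⟨0, hJ.zero_mem⟩
      down := fun h hb => hJ.down (proj_le h) hb
      add := fun ha hb h => hJ.add ha hb (proj_isSum h) }
  have hsub : I ⊆ {x | proj hE hI x ∈ J} := by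
    intro x hx
    change proj hE hI x ∈ J
    rw [proj_eq_zero_iff.2 hx]
    exact hJ.zero_mem
  by_cases h : {x | proj hE hI x ∈ J} = Set.univ
  · right
    ext X
    obtain ⟨x, rfl⟩ := proj_surj X
    exact ⟨fun _ => trivial, fun _ => (Set.ext_iff.1 h x).2 trivial⟩
  · left
    have heq : {x | proj hE hI x ∈ J} ⊆ I := by
      by_contra hne
      exact hmax.2.2 _ hpre h ⟨hsub, hne⟩
    ext X
    obtain ⟨x, rfl⟩ := proj_surj X
    constructor
    · exact fun hx => proj_eq_zero_iff.2 (heq hx)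
    · intro hx
      rw [show proj hE hI x = 0 from hx]
      exact hJ.zero_mem

/-- The complement of e lies in the class 1, and strictness lifts x/I < 1. -/
theorem IsStrict.le_of_lt_one (hs : IsStrict hE hI) {x e : E} (he : e ∈ I)
    (hx : proj hE hI x ≠ 1) : Le x (compl e) := by
  refine (hs x (compl e) ?_).1
  rw [proj_compl_eq_one he]
  exact ⟨le_one' _, hx⟩

theorem IsStrict.exists_isSum (hs : IsStrict hE hI) {x e : E} (he : e ∈ I)
    (hx : proj hE hI x ≠ 1) : ∃ c, IsSum x e c :=
  exists_isSum_of_le_compl (hs.le_of_lt_one he hx)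

theorem IsStrict.le_of_ne_zero (hs : IsStrict hE hI) {x e : E} (he : e ∈ I)
    (hx : proj hE hI x ≠ 0) : Le e x := by
  refine (hs e x ?_).1
  rw [proj_eq_zero_iff.2 he]
  exact ⟨zero_le' _, Ne.symm hx⟩

variable {H K : Type*} [AddCommGroup H] [PartialOrder H] [IsOrderedAddMonoid H]
  [AddCommGroup K] [PartialOrder K] [IsOrderedAddMonoid K] {φ : Quo hE hI → H} {ι : E → K}

/-- The coordinates are x ↦ (φ(x/I), ι(x) - ι(δ(x/I))). The offset lies in the subgroup generated by
I because x and δ(x/I) are congruent; additivity of δ makes the offsets additive. -/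
theorem isomorphic_lex (hφ : IsAmbient φ) (hι : IsAmbient ι)
    (hadd : ∀ a ∈ I, ∀ b ∈ I, ∃ c, IsSum a b c) (hs : IsStrict hE hI)
    {δ : Quo hE hI → E} (hδ : IsHom δ) (hδ' : ∀ X, proj hE hI (δ X) = X) :
    Isomorphic E (Gam (toLex (φ 1, 0) : H ×ₗ hι.idealSubgroup hI hadd)
      (lex_nonneg (hφ.nonneg 1))) := by
  have hδ0 : δ 0 = 0 := by
    have h := hδ.map_sum (zero_isSum (0 : Quo hE hI))
    exact isSum_cancel h (isSum_zero _)
  have hmem : ∀ x : E, ι x - ι (δ (proj hE hI x)) ∈ hι.idealSubgroup hI hadd := by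
    intro x
    obtain ⟨e, he, f, hf, c, h1, h2⟩ := proj_eq.1 (hδ' (proj hE hI x)).symm
    refine ⟨e, he, f, hf, ?_⟩
    rw [← hι.isSum_iff.1 h1, ← hι.isSum_iff.1 h2]
    abel
  let g : E → hι.idealSubgroup hI hadd := fun x => ⟨ι x - ι (δ (proj hE hI x)), hmem x⟩
  have h0 : ∀ x, (0 : H ×ₗ hι.idealSubgroup hI hadd) ≤ toLex (φ (proj hE hI x), g x) := by
    intro x
    refine Prod.Lex.toLex_le_toLex'.2 ⟨hφ.nonneg _, fun h => ?_⟩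
    have hx : proj hE hI x = 0 := hφ.injective (h.symm.trans hφ.map_zero.symm)
    change (0 : K) ≤ ι x - ι (δ (proj hE hI x))
    rw [hx, hδ0, hι.map_zero, sub_zero]
    exact hι.nonneg x
  have h1 : ∀ x, (toLex (φ (proj hE hI x), g x) : H ×ₗ hι.idealSubgroup hI hadd) ≤
      toLex (φ 1, 0) := by
    intro x
    refine Prod.Lex.toLex_le_toLex'.2 ⟨hφ.le_map_one _, fun h => ?_⟩
    have hx : proj hE hI x = 1 := hφ.injective h
    change ι x - ι (δ (proj hE hI x)) ≤ (0 : K)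
    rw [hx, hδ.map_one, sub_nonpos]
    exact hι.le_map_one x
  let Φ : E → Gam (toLex (φ 1, 0) : H ×ₗ hι.idealSubgroup hI hadd)
      (lex_nonneg (hφ.nonneg 1)) := fun x => ⟨toLex (φ (proj hE hI x), g x), h0 x, h1 x⟩
  have hΦ : ∀ {x : E} {w : Gam (toLex (φ 1, 0) : H ×ₗ hι.idealSubgroup hI hadd)
      (lex_nonneg (hφ.nonneg 1))}, Φ x = w ↔ φ (proj hE hI x) = (ofLex w.1).1 ∧
        ι x - ι (δ (proj hE hI x)) = (ofLex w.1).2 := by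
    intro x w
    constructor
    · rintro rfl
      exact ⟨rfl, rfl⟩
    · rintro ⟨e1, e2⟩
      exact Subtype.ext (congrArg toLex (Prod.ext e1 (Subtype.ext e2)))
  have hinj : Function.Injective Φ := by
    intro x y hxy
    obtain ⟨e1, e2⟩ := hΦ.1 hxy
    have e1 : proj hE hI x = proj hE hI y := hφ.injective e1
    have e2 : ι x - ι (δ (proj hE hI x)) = ι y - ι (δ (proj hE hI y)) := e2
    rw [e1] at e2
    exact hι.injective (sub_left_injective e2)
  have hsurj : Function.Surjective Φ := by
    rintro ⟨w, hw0, hw1⟩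
    obtain ⟨t, k, rfl⟩ : ∃ t k, w = toLex (t, k) := ⟨_, _, rfl⟩
    obtain ⟨ht0, hk0⟩ := Prod.Lex.toLex_le_toLex'.1 hw0
    obtain ⟨ht1, hk1⟩ := Prod.Lex.toLex_le_toLex'.1 hw1
    obtain ⟨X, rfl⟩ := hφ.exists_iff.2 ⟨ht0, ht1⟩
    suffices h : ∃ x, proj hE hI x = X ∧ ι x = ι (δ X) + k by
      obtain ⟨x, rfl, h⟩ := h
      exact ⟨x, hΦ.2 ⟨rfl, sub_eq_of_eq_add' h⟩⟩
    -- Over 0 and 1 the lexicographic bounds give k a sign, and k or -k comes from an element of I.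
    -- Over any other class k = ι e - ι f, and strictness allows f to be subtracted from δ X and e
    -- to be added to the result.
    by_cases hX0 : X = 0
    · subst hX0
      obtain ⟨e, he, hek⟩ := hι.exists_of_nonneg hI hadd k.2 (hk0 hφ.map_zero.symm)
      exact ⟨e, proj_eq_zero_iff.2 he, by rw [hδ0, hι.map_zero, zero_add, hek]⟩
    by_cases hX1 : X = 1
    · subst hX1
      obtain ⟨e, he, hek⟩ := hι.exists_of_nonneg hI hadd (-k).2 (neg_nonneg.2 (hk1 rfl))
      refine ⟨compl e, proj_compl_eq_one he, ?_⟩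
      rw [hδ.map_one, ← hι.isSum_iff.1 (isSum_compl e), hek, AddSubgroup.coe_neg]
      abel
    · obtain ⟨k, e, he, f, hf, rfl⟩ := k
      have hP : proj hE hI (δ X) = X := hδ' X
      obtain ⟨d, hd⟩ := hs.le_of_ne_zero hf (x := δ X) (by rwa [hP])
      have hdX : proj hE hI d = X := by
        rw [← hP]
        exact proj_eq.2 (rel_of_isSum hI hf hd).symm
      obtain ⟨x, hx⟩ := hs.exists_isSum he (x := d) (by rwa [hdX])
      refine ⟨x, ?_, ?_⟩
      · rw [← hdX]
        exact proj_eq.2 (rel_of_isSum hI he (isSum_comm hx))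
      · rw [← hι.isSum_iff.1 hx, ← hι.isSum_iff.1 hd]
        change ι d + ι e = ι f + ι d + (ι e - ι f)
        abel
  have hsum : ∀ {x y z : E}, IsSum (Φ x) (Φ y) (Φ z) ↔ IsSum x y z := by
    intro x y z
    have hιδ : IsSum (proj hE hI x) (proj hE hI y) (proj hE hI z) →
        ι (δ (proj hE hI x)) + ι (δ (proj hE hI y)) = ι (δ (proj hE hI z)) :=
      fun h => hι.isSum_iff.1 (hδ.map_sum h)
    constructor
    · intro h
      have h : toLex (φ (proj hE hI x), g x) + toLex (φ (proj hE hI y), g y) =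
        toLex (φ (proj hE hI z), g z) := h
      have e1 : φ (proj hE hI x) + φ (proj hE hI y) = φ (proj hE hI z) :=
        congrArg (fun w => (ofLex w).1) h
      have e2 : ι x - ι (δ (proj hE hI x)) + (ι y - ι (δ (proj hE hI y))) =
          ι z - ι (δ (proj hE hI z)) := congrArg (fun w => ((ofLex w).2 : K)) h
      -- The first coordinates give a sum of classes, hence of their origins under δ; cancelling the
      -- origins leaves the sum in E.
      rw [← hιδ (hφ.isSum_iff.2 e1), sub_add_sub_comm] at e2
      exact hι.isSum_iff.2 (sub_left_injective e2)
    · intro h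
      have e := proj_isSum (hE := hE) (hI := hI) h
      refine congrArg toLex (Prod.ext (hφ.isSum_iff.1 e) (Subtype.ext ?_))
      change ι x - ι (δ (proj hE hI x)) + (ι y - ι (δ (proj hE hI y))) =
          ι z - ι (δ (proj hE hI z))
      rw [← hιδ e, ← hι.isSum_iff.1 h, sub_add_sub_comm]
  have hone : Φ 1 = 1 := by
    refine hΦ.2 ⟨rfl, ?_⟩
    change ι 1 - ι (δ 1) = 0
    rw [hδ.map_one, sub_self]
  have hbij : Function.Bijective Φ := ⟨hinj, hsurj⟩
  have hinv : ∀ w, Φ ((Equiv.ofBijective Φ hbij).symm w) = w :=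
    (Equiv.ofBijective Φ hbij).apply_symm_apply
  refine ⟨Equiv.ofBijective Φ hbij, ⟨hone, hsum.2⟩, ⟨?_, fun {a b c} h => hsum.1 ?_⟩⟩
  · rw [Equiv.symm_apply_eq]
    exact hone.symm
  · rwa [hinv, hinv, hinv]

end Quotients

theorem IsStrongUnit.pos {H : Type*} [AddCommGroup H] [PartialOrder H] [IsOrderedAddMonoid H]
    {u : H} (hu : IsStrongUnit u) (hH : Nontrivial H) : 0 < u := by
  refine lt_of_le_of_ne hu.nonneg ?_
  rintro rfl
  have h : ∀ x : H, x ≤ 0 := fun x => by simpa using hu.bound x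
  obtain ⟨x, hx⟩ := exists_ne (0 : H)
  exact hx (le_antisymm (h x) (neg_nonpos.1 (h (-x))))

end EffectAlgebra

/-! ### The equivalence. -/

theorem theorem6p3 {E : Type w} [EffectAlgebra E] (hE : EffectAlgebra.HasRDP E) :
    List.TFAE
      [EffectAlgebra.IsLocal E ∧
          EffectAlgebra.IsRetractive hE (EffectAlgebra.isIdeal_rad E) ∧
          EffectAlgebra.IsStrict hE (EffectAlgebra.isIdeal_rad E),
        ∃ (H : Type w) (_ : AddCommGroup H) (_ : PartialOrder H) (_ : IsOrderedAddMonoid H)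
          (u : H) (hu : EffectAlgebra.IsStrongUnit u),
          EffectAlgebra.GroupHasRDP H ∧
          EffectAlgebra.IsAntilattice H ∧
          EffectAlgebra.IsSimplePoGroup H ∧
          EffectAlgebra.IsArchimedean (EffectAlgebra.Gam u hu.nonneg) ∧
          EffectAlgebra.IsStrongPerfect E u,
        ∃ (H : Type w) (_ : AddCommGroup H) (_ : PartialOrder H) (_ : IsOrderedAddMonoid H)
          (u : H) (hu : EffectAlgebra.IsStrongUnit u),
          EffectAlgebra.GroupHasRDP H ∧
          EffectAlgebra.IsAntilattice H ∧
          EffectAlgebra.IsSimplePoGroup H ∧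
          EffectAlgebra.IsArchimedean (EffectAlgebra.Gam u hu.nonneg) ∧
          ∃ (G : Type w) (_ : AddCommGroup G) (_ : PartialOrder G) (_ : IsOrderedAddMonoid G),
            EffectAlgebra.IsDirectedGroup G ∧
            EffectAlgebra.GroupHasRDP G ∧
            EffectAlgebra.Isomorphic E
              (EffectAlgebra.Gam (toLex (u, 0) : H ×ₗ G)
                (EffectAlgebra.lex_nonneg hu.nonneg))] := by
  tfae_have 1 → 3 := by
    rintro ⟨⟨I, hmax, huniq⟩, ⟨δ, hδ, hδ'⟩, hs⟩
    have hRad : EffectAlgebra.Rad E = I := by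
      have : ∀ J : Set E, EffectAlgebra.IsMaximalIdeal J ↔ J = I :=
        fun J => ⟨huniq J, fun h => h ▸ hmax⟩
      simp [EffectAlgebra.Rad, this]
    rw [← hRad] at hmax
    have h01 : (1 : EffectAlgebra.Quo hE (EffectAlgebra.isIdeal_rad E)) ≠ 0 := fun h =>
      hmax.2.1 (hmax.1.eq_univ (EffectAlgebra.proj_eq_zero_iff.1 h))
    -- Radical elements lie in the class 0, which differs from the class 1, so strictness makes
    -- their sums defined.
    have hadd : ∀ a ∈ EffectAlgebra.Rad E, ∀ b ∈ EffectAlgebra.Rad E,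
        ∃ c, EffectAlgebra.IsSum a b c := fun a ha b hb => hs.exists_isSum hb (by
      rw [EffectAlgebra.proj_eq_zero_iff.2 ha]
      exact h01.symm)
    obtain ⟨K, _, _, _, ι, hι⟩ := EffectAlgebra.exists_isAmbient hE
    obtain ⟨H, _, _, _, φ, hφ⟩ := EffectAlgebra.exists_isAmbient
      (EffectAlgebra.hasRDP_quo (hE := hE) (hI := EffectAlgebra.isIdeal_rad E))
    have hH := hφ.isSimplePoGroup h01 hmax.quo_ideal
    exact ⟨H, _, _, _, φ 1, hφ.isStrongUnit, hφ.hasRDP, hH.isAntilattice hφ.hasRDP, hH,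
      hH.isArchimedean _, hι.idealSubgroup (EffectAlgebra.isIdeal_rad E) hadd,
      inferInstance, inferInstance, inferInstance,
      hι.isDirectedGroup_idealSubgroup (EffectAlgebra.isIdeal_rad E) hadd,
      hι.hasRDP_idealSubgroup _ _,
      EffectAlgebra.isomorphic_lex hφ hι hadd hs hδ hδ'⟩
  tfae_have 3 → 2 := by
    rintro ⟨H, _, _, _, u, hu, hR, hA, hH, hArch, G, _, _, _, hG, -, f, hf, hf'⟩
    exact ⟨H, _, _, _, u, hu, hR, hA, hH, hArch, hE, hH.1, _,
      EffectAlgebra.isStrongDecomposition_of_isomorphic (hu.pos hH.1) hG hf hf'⟩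
  tfae_have 2 → 1 := by
    rintro ⟨H, _, _, _, u, hu, hR, -, hH, -, -, -, D, hD⟩
    exact hD.isLocal_isRetractive_isStrict (hu.pos hH.1) hH hR hE
  tfae_finish
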